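/- Let $H$ be a complex Hilbert space with orthonormal basis $\{E_k\}_{k\ge 0}$, let $U$ be the shift $UE_k=E_{k+1}$, and let $\mathcal{T}=C^*(U)$ be the Toeplitz C$^*$-algebra, that is, the C$^*$-algebra of operators on $H$ generated by $U$. For $k,l\ge 0$ let $P_{k,l}$ be the operator with $P_{k,l}E_m=E_k$ if $m=l$ and $P_{k,l}E_m=0$ if $m\neq l$. Let $\mathcal{K}^\infty$ be the set of operators $c=\sum_{k,l\ge 0}c_{k,l}P_{k,l}$ whose coefficients are rapidly decaying: $\sup_{k,l}(1+k+l)^N|c_{k,l}|<\infty$ for every $N\ge 0$. For a continuous function $g:\mathbb{R}/\mathbb{Z}\to\mathbb{C}$ let $T(g)$ be the Toeplitz operator on $H$ obtained by identifying $E_k$ with $e^{2\pi ikx}\in L^2(\mathbb{R}/\mathbb{Z})$ and compressing the operator of multiplication by $g$ to $H$. Put $$\mathcal{T}^\infty=\{T(g)+c:\ g\in C^\infty(\mathbb{R}/\mathbb{Z}),\ c\in\mathcal{K}^\infty\}\subseteq\mathcal{T}.$$ **Theorem.** The algebra $\mathcal{T}^\infty$ is closed under the smooth functional calculus of self-adjoint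 elements: if $a\in\mathcal{T}^\infty$ is self-adjoint and $f$ is a smooth complex-valued function on an open neighborhood in $\mathbb{R}$ of the spectrum $\sigma(a)$ of $a$, then $f(a)$, defined by the continuous functional calculus in $\mathcal{T}$, belongs to $\mathcal{T}^\infty$. -/

import Mathlib

open scoped ContDiff ENNReal InnerProductSpace
open MeasureTheory

noncomputable section

namespace SmoothToeplitz

variable {H : Type*} [NormedAddCommGroup H] [InnerProductSpace ℂ H] [CompleteSpace H]

/-- The linear isometry `H → K` that sends the basis vector `E k` to `v k`, for an orthonormal
sequence `v` in `K`. -/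
def basisIsometry (E : HilbertBasis ℕ ℂ H) {K : Type*} [NormedAddCommGroup K]
    [InnerProductSpace ℂ K] [CompleteSpace K] {v : ℕ → K} (hv : Orthonormal ℂ v) : H →ₗᵢ[ℂ] K :=
  hv.orthogonalFamily.linearIsometry.comp E.repr.toLinearIsometry

theorem basisIsometry_apply (E : HilbertBasis ℕ ℂ H) {K : Type*} [NormedAddCommGroup K]
    [InnerProductSpace ℂ K] [CompleteSpace K] {v : ℕ → K} (hv : Orthonormal ℂ v) (k : ℕ) :
    basisIsometry E hv (E k) = v k := by
  have h := hv.orthogonalFamily.linearIsometry_apply_single (i := k) (1 : ℂ)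
  simpa [basisIsometry, E.repr_self] using h

/-- The unilateral shift `U`, with `U (E k) = E (k + 1)`. -/
def shift (E : HilbertBasis ℕ ℂ H) : H →L[ℂ] H :=
  (basisIsometry E (E.orthonormal.comp Nat.succ Nat.succ_injective)).toContinuousLinearMap

theorem shift_apply (E : HilbertBasis ℕ ℂ H) (k : ℕ) : shift E (E k) = E (k + 1) :=
  basisIsometry_apply E (E.orthonormal.comp Nat.succ Nat.succ_injective) k

/-- The Toeplitz algebra: the C⋆-algebra of operators on `H` generated by the shift, i.e. the norm
closure of the (unital) star algebra generated by the shift. -/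
abbrev ToeplitzAlgebra (E : HilbertBasis ℕ ℂ H) : StarSubalgebra ℂ (H →L[ℂ] H) :=
  StarAlgebra.elemental ℂ (shift E)

/-- The matrix unit `P k l`, with `P k l (E l) = E k` and `P k l (E m) = 0` for `m ≠ l`. -/
def matrixUnit (E : HilbertBasis ℕ ℂ H) (k l : ℕ) : H →L[ℂ] H :=
  InnerProductSpace.rankOne ℂ (E k) (E l)

/-- Rapid decay of a double sequence in both indices. -/
def IsRapidlyDecaying (c : ℕ → ℕ → ℂ) : Prop :=
  ∀ N : ℕ, ∃ C : ℝ, ∀ k l : ℕ, (1 + (k : ℝ) + (l : ℝ)) ^ N * ‖c k l‖ ≤ C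

/-- Smooth compact operators with respect to `E`: the sums (in operator norm)
`∑ c k l • P k l` with rapidly decaying coefficients. -/
def IsSmoothCompact (E : HilbertBasis ℕ ℂ H) (a : H →L[ℂ] H) : Prop :=
  ∃ c : ℕ → ℕ → ℂ, IsRapidlyDecaying c ∧
    HasSum (fun p : ℕ × ℕ ↦ c p.1 p.2 • matrixUnit E p.1 p.2) a

/-- `L²(ℝ/ℤ)`, with respect to the Haar probability measure. -/
abbrev CircleL2 : Type := Lp ℂ 2 (AddCircle.haarAddCircle (T := (1 : ℝ)))

/-- Multiplication by the continuous function `f` on `L²(ℝ/ℤ)`. -/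
def mulOp (f : C(UnitAddCircle, ℂ)) : CircleL2 →L[ℂ] CircleL2 :=
  (ContinuousLinearMap.mul ℂ ℂ).holderL (AddCircle.haarAddCircle (T := (1 : ℝ))) ∞ 2 2
    (ContinuousMap.toLp ∞ AddCircle.haarAddCircle ℂ f)

/-- The isometric embedding of `H` in `L²(ℝ/ℤ)` that sends `E k` to the function
`x ↦ exp (2 * π * i * k * x)`, for `k ≥ 0`; its range is the Hardy space. -/
def hardyEmbedding (E : HilbertBasis ℕ ℂ H) : H →ₗᵢ[ℂ] CircleL2 :=
  basisIsometry E
    ((orthonormal_fourier (T := (1 : ℝ))).comp (fun k : ℕ ↦ (k : ℤ)) Nat.cast_injective)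

/-- The Toeplitz operator `T(f)` on `H`: the compression to `H` of multiplication by `f`. The
adjoint of the embedding of `H` in `L²(ℝ/ℤ)` is the orthogonal projection onto (the image of)
`H`. -/
def toeplitz (E : HilbertBasis ℕ ℂ H) (f : C(UnitAddCircle, ℂ)) : H →L[ℂ] H :=
  (hardyEmbedding E).toContinuousLinearMap.adjoint ∘L mulOp f ∘L
    (hardyEmbedding E).toContinuousLinearMap

/-- Smoothness of a function on `ℝ/ℤ`: its `1`-periodic lift to `ℝ` is smooth. -/
def IsSmoothSymbol (f : C(UnitAddCircle, ℂ)) : Prop :=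
  ContDiff ℝ ∞ (fun x : ℝ ↦ f (x : UnitAddCircle))

/-- The smooth Toeplitz algebra `𝒯^∞`, as a subset of the Toeplitz algebra: the elements of the
form `T(f) + c` with `f` smooth and `c` a smooth compact operator. -/
def smoothToeplitz (E : HilbertBasis ℕ ℂ H) : Set (ToeplitzAlgebra E) :=
  {a | ∃ (f : C(UnitAddCircle, ℂ)) (c : H →L[ℂ] H), IsSmoothSymbol f ∧ IsSmoothCompact E c ∧
    (a : H →L[ℂ] H) = toeplitz E f + c}

end SmoothToeplitz

end

/-! Membership in 𝒯^∞ can be read off the matrix of an operator b: its entries decay rapidly away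
from the diagonal, and so do, in all directions, the entries of δ(b) = U*b - bU*. Apart from column
zero, the latter are differences along diagonals, so they do not see a Toeplitz part. Conversely,
summing these differences recovers the compact part, and what remains is constant along diagonals
(`exists_eq_toeplitz_add`).

Once f is cut off to a smooth function on ℝ and a is scaled into the unit ball, the substitution x =
cos 2πt turns a Fourier series into an expansion f(a) = ∑ cₙ Tₙ(a) in Chebyshev polynomials, with cₙ
rapidly decaying. It then suffices that each weighted bound on the entries of Tₙ(a) and δ(Tₙ(a))
grows at most polynomially in n.

Both Tₙ(a)E_l and δ(Tₙ(a))E_l satisfy y_{n+2} = 2a y_{n+1} - yₙ + rₙ, whose solutions are controlled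
by ‖U_{n-1}(a)‖ ≤ n (second kind polynomials). Applying a power w^(m+1) of a diagonal weight
preserves the recurrence up to the commutator with a, which is only of order w^m because a decays
off the diagonal. Induction on m gives the bounds (`exists_norm_weightOp_recurrence_le`). Weights
are truncated so that the operators stay bounded; no constant depends on the truncation. -/

noncomputable section

namespace SmoothToeplitz

variable {H : Type*} [NormedAddCommGroup H] [InnerProductSpace ℂ H] [CompleteSpace H]

/-! ### Matrix coefficients and the Schur test -/

/-- The matrix coefficient `⟪E k, a (E l)⟫`. -/
def coeff (E : HilbertBasis ℕ ℂ H) (a : H →L[ℂ] H) (k l : ℕ) : ℂ := inner ℂ (E k) (a (E l))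

omit [CompleteSpace H] in
theorem ext_inner_basis (E : HilbertBasis ℕ ℂ H) {x y : H}
    (h : ∀ k, inner ℂ (E k) x = inner ℂ (E k) y) : x = y := by
  apply E.repr.injective
  ext k
  simpa [E.repr_apply_apply] using h k

omit [CompleteSpace H] in
theorem hasSum_coeff_mul (E : HilbertBasis ℕ ℂ H) (a : H →L[ℂ] H) (k : ℕ) (x : H) :
    HasSum (fun l ↦ coeff E a k l * inner ℂ (E l) x) (inner ℂ (E k) (a x)) := by
  have h := ((E.hasSum_repr x).mapL a).mapL (innerSL ℂ (E k))
  simpa [coeff, E.repr_apply_apply, inner_smul_right, mul_comm] using h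

omit [CompleteSpace H] in
theorem ext_coeff (E : HilbertBasis ℕ ℂ H) {a b : H →L[ℂ] H}
    (h : ∀ k l, coeff E a k l = coeff E b k l) : a = b := by
  ext x
  refine ext_inner_basis E fun k ↦ (hasSum_coeff_mul E a k x).unique ?_
  simpa only [h] using hasSum_coeff_mul E b k x

-- Parseval in `ℝ≥0∞`, so that the double sums of the Schur test can be interchanged freely.
omit [CompleteSpace H] in
theorem tsum_enorm_inner_sq (E : HilbertBasis ℕ ℂ H) (x : H) :
    ∑' k, ‖inner ℂ (E k) x‖ₑ ^ 2 = ‖x‖ₑ ^ 2 := by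
  have h := (E.hasSum_inner_mul_inner x x).mapL Complex.reCLM
  have h2 : HasSum (fun k ↦ ‖inner ℂ (E k) x‖ ^ 2) (‖x‖ ^ 2) := by
    convert h using 2 with k
    · rw [← inner_conj_symm, Complex.mul_conj', RCLike.norm_conj]
      norm_cast
    · simp [inner_self_eq_norm_sq_to_K, ← Complex.ofReal_pow]
  have h3 := h2.tsum_eq
  have h4 := ENNReal.ofReal_tsum_of_nonneg (fun k ↦ by positivity) h2.summable
  rw [h3] at h4
  simpa [ENNReal.ofReal_pow] using h4.symm

theorem summable_one_add_sq_inv : Summable fun n : ℕ ↦ ((1 + (n : ℝ)) ^ 2)⁻¹ := by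
  have := (summable_nat_add_iff 1).2 (Real.summable_nat_pow_inv.2 (one_lt_two))
  simpa [add_comm] using this

theorem summable_one_add_abs_sq_inv : Summable fun n : ℤ ↦ ((1 + |(n : ℝ)|) ^ 2)⁻¹ := by
  exact Summable.of_nat_of_neg (by simpa using summable_one_add_sq_inv)
    (by simpa using summable_one_add_sq_inv)

/-- The sum of `(1 + |n|)⁻²` over the integers. -/
def schurSum : ℝ := ∑' n : ℤ, ((1 + |(n : ℝ)|) ^ 2)⁻¹

theorem schurSum_nonneg : 0 ≤ schurSum := tsum_nonneg fun _ ↦ by positivity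

theorem tsum_ofReal_le_schurSum (k : ℕ) :
    ∑' l : ℕ, ENNReal.ofReal (((1 + |(k : ℝ) - l|) ^ 2)⁻¹) ≤ ENNReal.ofReal schurSum := by
  rw [schurSum, ENNReal.ofReal_tsum_of_nonneg (fun _ ↦ by positivity) summable_one_add_abs_sq_inv]
  have hinj : Function.Injective (fun l : ℕ ↦ (k : ℤ) - l) := fun a b h ↦ by
    simp only at h; omega
  simpa using ENNReal.tsum_comp_le_tsum_of_injective hinj
    (fun n : ℤ ↦ ENNReal.ofReal (((1 + |(n : ℝ)|) ^ 2)⁻¹))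

omit [CompleteSpace H] in
/-- A Schur test: off-diagonal decay of order two bounds the operator norm. -/
theorem norm_le_of_coeff_le (E : HilbertBasis ℕ ℂ H) (a : H →L[ℂ] H) {C : ℝ}
    (h : ∀ k l : ℕ, (1 + |(k : ℝ) - l|) ^ 2 * ‖coeff E a k l‖ ≤ C) :
    ‖a‖ ≤ C * (2 * schurSum) := by
  have hC : 0 ≤ C := le_trans (by positivity) (h 0 0)
  set β : ℕ → ℕ → ℝ≥0∞ := fun k l ↦ ENNReal.ofReal (((1 + |(k : ℝ) - l|) ^ 2)⁻¹) with hβ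
  have hβs : ∀ k l, β k l = β l k := fun k l ↦ by simp only [hβ, abs_sub_comm]
  have hc : ∀ k l, ‖coeff E a k l‖ₑ ≤ ENNReal.ofReal C * β k l := by
    intro k l
    rw [hβ, ← ENNReal.ofReal_mul hC, ← ofReal_norm]
    apply ENNReal.ofReal_le_ofReal
    rw [← div_eq_mul_inv, le_div_iff₀ (by positivity), mul_comm]
    exact h k l
  refine ContinuousLinearMap.opNorm_le_of_re_inner_le
    (mul_nonneg hC (mul_nonneg zero_le_two schurSum_nonneg)) fun y x hy hx ↦ ?_
  have hx2 : ∑' k, ‖inner ℂ (E k) x‖ₑ ^ 2 = 1 := by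
    rw [tsum_enorm_inner_sq, ← ofReal_norm, hx]; simp
  have hy2 : ∑' k, ‖inner ℂ (E k) y‖ₑ ^ 2 = 1 := by
    rw [tsum_enorm_inner_sq, ← ofReal_norm, hy]; simp
  have key : ‖(inner ℂ x (a y) : ℂ)‖ₑ ≤ ENNReal.ofReal (C * (2 * schurSum)) := by
    calc ‖(inner ℂ x (a y) : ℂ)‖ₑ
        = ‖∑' k, inner ℂ x (E k) * inner ℂ (E k) (a y)‖ₑ := by rw [E.tsum_inner_mul_inner]
      _ ≤ ∑' k, ‖inner ℂ x (E k) * inner ℂ (E k) (a y)‖ₑ := enorm_tsum_le_tsum_enorm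
      _ ≤ ∑' k, ∑' l, ENNReal.ofReal C *
            (β k l * ‖inner ℂ (E k) x‖ₑ ^ 2 + β k l * ‖inner ℂ (E l) y‖ₑ ^ 2) := by
          refine ENNReal.tsum_le_tsum fun k ↦ ?_
          rw [← (hasSum_coeff_mul E a k y).tsum_eq, enorm_mul]
          refine (mul_le_mul_right enorm_tsum_le_tsum_enorm _).trans ?_
          rw [← ENNReal.tsum_mul_left]
          refine ENNReal.tsum_le_tsum fun l ↦ ?_
          rw [enorm_mul]
          have hs : ‖inner ℂ x (E k)‖ₑ = ‖inner ℂ (E k) x‖ₑ := by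
            rw [← ofReal_norm, ← ofReal_norm, norm_inner_symm]
          rw [hs]
          generalize ‖inner ℂ (E k) x‖ₑ = s
          generalize ‖inner ℂ (E l) y‖ₑ = t
          -- A crude form of 2st ≤ s² + t²; it accounts for the factor 2 in the bound.
          have hst : s * t ≤ s ^ 2 + t ^ 2 := by
            rcases le_total s t with hl | hl
            · calc s * t ≤ t * t := mul_le_mul_left hl t
                _ = t ^ 2 := (sq t).symm
                _ ≤ _ := le_add_self
            · calc s * t ≤ s * s := mul_le_mul_right hl s
                _ = s ^ 2 := (sq s).symm
                _ ≤ _ := le_self_add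
          calc s * (‖coeff E a k l‖ₑ * t) = ‖coeff E a k l‖ₑ * (s * t) := by ring
            _ ≤ (ENNReal.ofReal C * β k l) * (s ^ 2 + t ^ 2) := mul_le_mul' (hc k l) hst
            _ = _ := by ring
      _ = ENNReal.ofReal C * (∑' k, (∑' l, β k l) * ‖inner ℂ (E k) x‖ₑ ^ 2 +
            ∑' l, (∑' k, β l k) * ‖inner ℂ (E l) y‖ₑ ^ 2) := by
          simp_rw [ENNReal.tsum_mul_left, ENNReal.tsum_add, ENNReal.tsum_mul_right]
          congr 2
          rw [ENNReal.tsum_comm]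
          simp_rw [ENNReal.tsum_mul_right, hβs]
      _ ≤ ENNReal.ofReal C * (∑' k, ENNReal.ofReal schurSum * ‖inner ℂ (E k) x‖ₑ ^ 2 +
            ∑' l, ENNReal.ofReal schurSum * ‖inner ℂ (E l) y‖ₑ ^ 2) := by
          gcongr <;> exact tsum_ofReal_le_schurSum _
      _ = ENNReal.ofReal (C * (2 * schurSum)) := by
          rw [ENNReal.tsum_mul_left, ENNReal.tsum_mul_left, hx2, hy2, ENNReal.ofReal_mul hC,
            ENNReal.ofReal_mul zero_le_two]
          simp [two_mul]
  have h2 : ‖(inner ℂ x (a y) : ℂ)‖ ≤ C * (2 * schurSum) := by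
    rw [← ofReal_norm] at key
    exact (ENNReal.ofReal_le_ofReal_iff
      (mul_nonneg hC (mul_nonneg zero_le_two schurSum_nonneg))).1 key
  calc _ ≤ ‖inner ℂ (a y) x‖ := RCLike.re_le_norm _
    _ = ‖inner ℂ x (a y)‖ := norm_inner_symm _ _
    _ ≤ _ := h2

/-- Rapid decay of the matrix coefficients away from the diagonal. -/
def IsOffDiagDecaying (E : HilbertBasis ℕ ℂ H) (a : H →L[ℂ] H) : Prop :=
  ∀ m : ℕ, ∃ C : ℝ, ∀ k l : ℕ, (1 + |(k : ℝ) - l|) ^ m * ‖coeff E a k l‖ ≤ C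

/-! ### Weights and diagonal operators -/

/-- Weights on `ℕ`: at least `1`, `1`-Lipschitz and eventually constant. -/
structure IsWeight (w : ℕ → ℝ) : Prop where
  one_le : ∀ k, 1 ≤ w k
  lipschitz : ∀ k l, |w k - w l| ≤ |(k : ℝ) - l|
  eventually_const : ∃ K, ∀ k, K ≤ k → w k = w K

theorem IsWeight.pos {w : ℕ → ℝ} (hw : IsWeight w) (k : ℕ) : 0 < w k :=
  one_pos.trans_le (hw.one_le k)

theorem IsWeight.le_mul {w : ℕ → ℝ} (hw : IsWeight w) (k l : ℕ) :
    w k ≤ w l * (1 + |(k : ℝ) - l|) := by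
  have h1 := (abs_le.1 (hw.lipschitz k l)).2
  have h2 := mul_le_mul_of_nonneg_right (hw.one_le l) (abs_nonneg ((k : ℝ) - l))
  linarith

/-- One power of the weight is gained, at the price of powers of the distance, which off-diagonal
decay absorbs. -/
theorem IsWeight.abs_pow_sub_pow_le {w : ℕ → ℝ} (hw : IsWeight w) (m k l : ℕ) :
    |w k ^ (m + 1) - w l ^ (m + 1)| ≤ (m + 1) * (1 + |(k : ℝ) - l|) ^ (m + 1) * w l ^ m := by
  set d := |(k : ℝ) - l| with hd
  have hd0 : 0 ≤ d := abs_nonneg _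
  have hwl := (hw.pos l).le
  induction m with
  | zero => simpa using (hw.lipschitz k l).trans (by linarith)
  | succ m ih =>
    calc |w k ^ (m + 1 + 1) - w l ^ (m + 1 + 1)|
        = |w k * (w k ^ (m + 1) - w l ^ (m + 1)) + (w k - w l) * w l ^ (m + 1)| := by
          congr 1; ring
      _ ≤ w k * |w k ^ (m + 1) - w l ^ (m + 1)| + |w k - w l| * w l ^ (m + 1) := by
          refine (abs_add_le _ _).trans ?_
          rw [abs_mul, abs_mul, abs_of_pos (hw.pos k), abs_of_nonneg (pow_nonneg hwl (m + 1))]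
      _ ≤ (w l * (1 + d)) * ((m + 1) * (1 + d) ^ (m + 1) * w l ^ m)
            + (1 + d) ^ (m + 2) * w l ^ (m + 1) := by
          have h1 : |w k - w l| ≤ (1 + d) ^ (m + 2) :=
            (hw.lipschitz k l).trans ((by linarith : d ≤ 1 + d).trans
              (le_self_pow₀ (by linarith) (by omega)))
          have h2 := hw.le_mul k l
          gcongr
      _ = _ := by push_cast; ring

/-- The weight `k ↦ min (1 + |k - p|) R`. -/
def truncWeight (p R : ℕ) (k : ℕ) : ℝ := min (1 + |(k : ℝ) - p|) (R + 1)

theorem isWeight_truncWeight (p R : ℕ) : IsWeight (truncWeight p R) where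
  -- Truncating at R + 1 keeps the weight at least 1 even for R = 0.
  one_le k := le_min (by linarith [abs_nonneg ((k : ℝ) - p)]) (by simp)
  lipschitz k l := by
    refine (abs_min_sub_min_le_max _ _ _ _).trans ?_
    simp only [sub_self, abs_zero, add_sub_add_left_eq_sub]
    refine max_le ((abs_abs_sub_abs_le _ _).trans (by simp)) (abs_nonneg _)
  eventually_const := by
    refine ⟨p + R, fun k hk ↦ ?_⟩
    have h : ∀ j : ℕ, p + R ≤ j → truncWeight p R j = R + 1 := fun j hj ↦ by
      have : (p : ℝ) + R ≤ j := by exact_mod_cast hj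
      exact min_eq_right (by linarith [le_abs_self ((j : ℝ) - p)])
    rw [h k hk, h _ le_rfl]

open Classical in
/-- The diagonal operator `E k ↦ u k • E k`, for an eventually constant sequence `u`. -/
def diagOp (E : HilbertBasis ℕ ℂ H) (u : ℕ → ℝ) : H →L[ℂ] H :=
  if h : ∃ K, ∀ k, K ≤ k → u k = u K then
    (u h.choose : ℂ) • 1 +
      ∑ k ∈ Finset.range h.choose, ((u k - u h.choose : ℝ) : ℂ) • matrixUnit E k k
  else 0

omit [CompleteSpace H] in
theorem inner_diagOp (E : HilbertBasis ℕ ℂ H) {u : ℕ → ℝ} (h : ∃ K, ∀ k, K ≤ k → u k = u K)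
    (j : ℕ) (x : H) : inner ℂ (E j) (diagOp E u x) = u j * inner ℂ (E j) x := by
  rw [diagOp, dif_pos h]
  have hK := h.choose_spec
  set K := h.choose
  have e : ∀ k, inner ℂ (E j) (E k) = if j = k then (1 : ℂ) else 0 :=
    orthonormal_iff_ite.1 E.orthonormal j
  simp only [add_apply, smul_apply,
    one_apply_eq_self, sum_apply, matrixUnit,
    InnerProductSpace.rankOne_apply, inner_add_right, inner_smul_right, inner_sum, e]
  simp only [mul_ite, mul_one, mul_zero, Finset.sum_ite_eq, Finset.mem_range]
  split_ifs with hj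
  · push_cast; ring
  · rw [hK j (not_lt.1 hj)]; ring

omit [CompleteSpace H] in
theorem diagOp_basis (E : HilbertBasis ℕ ℂ H) {u : ℕ → ℝ} (h : ∃ K, ∀ k, K ≤ k → u k = u K)
    (l : ℕ) : diagOp E u (E l) = (u l : ℂ) • E l := by
  refine ext_inner_basis E fun k ↦ ?_
  rw [inner_diagOp E h, inner_smul_right, orthonormal_iff_ite.1 E.orthonormal]
  split_ifs with hkl <;> simp [hkl]

theorem IsWeight.eventually_const_comp {w : ℕ → ℝ} (hw : IsWeight w) (φ : ℝ → ℝ) :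
    ∃ K, ∀ k, K ≤ k → φ (w k) = φ (w K) :=
  hw.eventually_const.imp fun _ hK k hk ↦ by rw [hK k hk]

/-- The `m`-th power of the diagonal operator of a weight. -/
abbrev weightOp (E : HilbertBasis ℕ ℂ H) (w : ℕ → ℝ) (m : ℕ) : H →L[ℂ] H :=
  diagOp E (fun k ↦ w k ^ m)

omit [CompleteSpace H] in
theorem inner_weightOp (E : HilbertBasis ℕ ℂ H) {w : ℕ → ℝ} (hw : IsWeight w) (m j : ℕ) (x : H) :
    inner ℂ (E j) (weightOp E w m x) = (w j : ℂ) ^ m * inner ℂ (E j) x := by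
  rw [weightOp, inner_diagOp E (hw.eventually_const_comp (· ^ m))]
  push_cast; rfl

omit [CompleteSpace H] in
theorem weightOp_basis (E : HilbertBasis ℕ ℂ H) {w : ℕ → ℝ} (hw : IsWeight w) (m l : ℕ) :
    weightOp E w m (E l) = (w l : ℂ) ^ m • E l := by
  rw [weightOp, diagOp_basis E (hw.eventually_const_comp (· ^ m))]
  push_cast; rfl

omit [CompleteSpace H] in
theorem weightOp_zero (E : HilbertBasis ℕ ℂ H) {w : ℕ → ℝ} (hw : IsWeight w) (x : H) :
    weightOp E w 0 x = x :=
  ext_inner_basis E fun k ↦ by simp [inner_weightOp E hw]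

omit [CompleteSpace H] in
theorem mul_norm_inner_le (E : HilbertBasis ℕ ℂ H) {w : ℕ → ℝ} (hw : IsWeight w) (m j : ℕ)
    (x : H) : w j ^ m * ‖inner ℂ (E j) x‖ ≤ ‖weightOp E w m x‖ := by
  have h := norm_inner_le_norm (𝕜 := ℂ) (E j) (weightOp E w m x)
  rwa [inner_weightOp E hw, norm_mul, norm_pow, E.orthonormal.1, one_mul, Complex.norm_real,
    Real.norm_of_nonneg (hw.pos j).le] at h

omit [CompleteSpace H] in
/-- The commutator of `w ^ (m + 1)` with an operator with off-diagonal decay is of order `m`,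
uniformly in the weight `w`. -/
theorem IsOffDiagDecaying.exists_norm_commutator_le {E : HilbertBasis ℕ ℂ H} {a : H →L[ℂ] H}
    (ha : IsOffDiagDecaying E a) (m : ℕ) : ∃ C : ℝ, 0 ≤ C ∧ ∀ w, IsWeight w → ∀ y : H,
      ‖weightOp E w (m + 1) (a y) - a (weightOp E w (m + 1) y)‖ ≤ C * ‖weightOp E w m y‖ := by
  -- The difference of powers costs m + 1 orders of decay and the Schur test two more.
  obtain ⟨A, hA⟩ := ha (m + 3)
  have hA0 : 0 ≤ A := le_trans (by positivity) (hA 0 0)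
  refine ⟨((m + 1) * A) * (2 * schurSum), mul_nonneg (by positivity)
    (mul_nonneg zero_le_two schurSum_nonneg), fun w hw y ↦ ?_⟩
  set V := diagOp E (fun k ↦ (w k ^ m)⁻¹) with hV
  have hVi := inner_diagOp E (hw.eventually_const_comp (fun x ↦ (x ^ m)⁻¹))
  have hVb := diagOp_basis E (hw.eventually_const_comp (fun x ↦ (x ^ m)⁻¹))
  have hVW : V (weightOp E w m y) = y := ext_inner_basis E fun k ↦ by
    have : (w k : ℂ) ≠ 0 := by exact_mod_cast (hw.pos k).ne'
    rw [hV, hVi, inner_weightOp E hw]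
    push_cast
    field_simp
  -- The commutator divided by w^m on the right; the Schur test bounds it, uniformly in w.
  set K := (weightOp E w (m + 1) ∘L a - a ∘L weightOp E w (m + 1)) ∘L V with hK
  have hKn : ‖K‖ ≤ ((m + 1) * A) * (2 * schurSum) := by
    refine norm_le_of_coeff_le E K fun k l ↦ ?_
    have hwl := hw.pos l
    have e : coeff E K k l =
        (((w k ^ (m + 1) - w l ^ (m + 1)) * (w l ^ m)⁻¹ : ℝ) : ℂ) * coeff E a k l := by
      simp only [coeff, hK, ContinuousLinearMap.comp_apply, sub_apply,
        inner_sub_right, hV, hVb, map_smul, inner_smul_right, inner_weightOp E hw,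
        weightOp_basis E hw]
      push_cast; ring
    rw [e, norm_mul, Complex.norm_real, Real.norm_eq_abs, abs_mul, abs_inv,
      abs_of_pos (pow_pos hwl m)]
    set d := |(k : ℝ) - l|
    have hd : 0 ≤ d := abs_nonneg _
    calc (1 + d) ^ 2 * (|w k ^ (m + 1) - w l ^ (m + 1)| * (w l ^ m)⁻¹ * ‖coeff E a k l‖)
        ≤ (1 + d) ^ 2 * ((m + 1) * (1 + d) ^ (m + 1) * w l ^ m * (w l ^ m)⁻¹
            * ‖coeff E a k l‖) := by
          gcongr
          exact hw.abs_pow_sub_pow_le m k l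
      _ = (m + 1) * ((1 + d) ^ (m + 3) * ‖coeff E a k l‖) := by
          rw [mul_inv_cancel_right₀ (pow_pos hwl m).ne']; ring
      _ ≤ (m + 1) * A := by
          gcongr
          exact hA k l
  calc _ = ‖K (weightOp E w m y)‖ := by
        simp [hK, ContinuousLinearMap.comp_apply, hVW]
    _ ≤ _ := K.le_of_opNorm_le hKn _

-- The weight centred at p equals 1 there, so it fixes E p and only the commutator with a has to be
-- estimated.
omit [CompleteSpace H] in
theorem IsOffDiagDecaying.exists_norm_weightOp_le {E : HilbertBasis ℕ ℂ H} {a : H →L[ℂ] H}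
    (ha : IsOffDiagDecaying E a) (m : ℕ) : ∃ C : ℝ, ∀ p R,
      ‖weightOp E (truncWeight p R) m (a (E p))‖ ≤ C := by
  have hb : ∀ p R m, ‖weightOp E (truncWeight p R) m (E p)‖ = 1 := fun p R m ↦ by
    rw [weightOp_basis E (isWeight_truncWeight p R), norm_smul, E.orthonormal.1]
    simp [truncWeight]
  cases m with
  | zero =>
    refine ⟨‖a‖, fun p R ↦ ?_⟩
    rw [weightOp_zero E (isWeight_truncWeight p R)]
    simpa [E.orthonormal.1] using a.le_opNorm (E p)
  | succ m =>
    obtain ⟨C, -, h⟩ := ha.exists_norm_commutator_le m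
    refine ⟨C + ‖a‖, fun p R ↦ ?_⟩
    have h1 := h _ (isWeight_truncWeight p R) (E p)
    rw [hb, mul_one] at h1
    have h2 := a.le_opNorm (weightOp E (truncWeight p R) (m + 1) (E p))
    rw [hb, mul_one] at h2
    calc _ ≤ _ := norm_le_norm_sub_add _ (a (weightOp E (truncWeight p R) (m + 1) (E p)))
      _ ≤ _ := add_le_add h1 h2

/-! ### Recurrences of Chebyshev type -/

open Polynomial

theorem norm_aeval_chebyshev_T_le {a : H →L[ℂ] H} (hsa : IsSelfAdjoint a) (ha : ‖a‖ ≤ 1) (n : ℤ) :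
    ‖aeval a (Chebyshev.T ℝ n)‖ ≤ 1 := by
  rw [← cfc_polynomial (Chebyshev.T ℝ n) a hsa]
  refine norm_cfc_le zero_le_one fun x hx ↦ ?_
  refine Chebyshev.abs_eval_T_real_le_one n ?_
  have h : ‖x‖ ≤ ‖a‖ * ‖(1 : H →L[ℂ] H)‖ := spectrum.norm_le_norm_mul_of_mem hx
  have h1 : ‖(1 : H →L[ℂ] H)‖ ≤ 1 := ContinuousLinearMap.norm_id_le
  calc |x| ≤ ‖a‖ * ‖(1 : H →L[ℂ] H)‖ := h
    _ ≤ 1 * 1 := by gcongr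
    _ = 1 := one_mul 1

/-- Each step of U_n = X U_{n-1} + T_n adds at most 1 to the norm; the index shift starts the
induction at U_{-1} = 0. -/
theorem norm_aeval_chebyshev_U_le {a : H →L[ℂ] H} (hsa : IsSelfAdjoint a) (ha : ‖a‖ ≤ 1) (n : ℕ) :
    ‖aeval a (Chebyshev.U ℝ ((n : ℤ) - 1))‖ ≤ n := by
  induction n with
  | zero => simp
  | succ n ih =>
    have h := Chebyshev.U_eq_X_mul_U_add_T ℝ ((n : ℤ) - 1)
    rw [show ((n + 1 : ℕ) : ℤ) - 1 = (n : ℤ) - 1 + 1 by push_cast; ring, h, map_add, map_mul,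
      aeval_X]
    calc _ ≤ ‖a‖ * ‖aeval a (Chebyshev.U ℝ ((n : ℤ) - 1))‖
          + ‖aeval a (Chebyshev.T ℝ ((n : ℤ) - 1 + 1))‖ :=
          (norm_add_le _ _).trans (add_le_add (norm_mul_le _ _) le_rfl)
      _ ≤ 1 * n + 1 := by
          gcongr
          exact norm_aeval_chebyshev_T_le hsa ha _
      _ = _ := by push_cast; ring

-- Duhamel's formula. The induction passes to the sequences shifted by one, hence the quantifiers
-- over y and r after n.
omit [CompleteSpace H] in
theorem chebyshev_recurrence_eq (a : H →L[ℂ] H) (n : ℕ) : ∀ y r : ℕ → H,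
    (∀ n, y (n + 2) = (2 : ℂ) • a (y (n + 1)) - y n + r n) →
    y (n + 1) = aeval a (Chebyshev.U ℝ (((n + 1 : ℕ) : ℤ) - 1)) (y 1)
      - aeval a (Chebyshev.U ℝ ((n : ℤ) - 1)) (y 0)
      + ∑ j ∈ Finset.range n, aeval a (Chebyshev.U ℝ (((n - j : ℕ) : ℤ) - 1)) (r j) := by
  induction n with
  | zero => intro y r h; simp
  | succ n ih =>
    intro y r h
    have h1 := ih (fun n ↦ y (n + 1)) (fun n ↦ r (n + 1)) (fun n ↦ h (n + 1))
    simp only [zero_add] at h1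
    rw [h1, Finset.sum_range_succ', h 0]
    have hU : aeval a (Chebyshev.U ℝ (((n + 1 + 1 : ℕ) : ℤ) - 1)) =
        aeval a (Chebyshev.U ℝ (((n + 1 : ℕ) : ℤ) - 1)) * ((2 : ℂ) • a)
          - aeval a (Chebyshev.U ℝ ((n : ℤ) - 1)) := by
      rw [show (((n + 1 + 1 : ℕ) : ℤ) - 1) = (n : ℤ) - 1 + 2 by push_cast; ring,
        Chebyshev.U_add_two, show (((n + 1 : ℕ) : ℤ) - 1) = (n : ℤ) - 1 + 1 by push_cast; ring,
        mul_comm (2 * X : ℝ[X]), map_sub, map_mul, map_mul, aeval_X, map_ofNat,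
        two_smul, ← two_mul]
    rw [hU]
    simp only [sub_apply, mul_apply_eq_comp,
      smul_apply, map_add, map_sub, map_smul, Nat.add_sub_add_right,
      Nat.sub_zero, zero_add]
    abel

/-- The sources are bounded only for j < n, so D may depend on n, as it does in the weighted
induction. -/
theorem norm_chebyshev_recurrence_le {a : H →L[ℂ] H} (hsa : IsSelfAdjoint a) (ha : ‖a‖ ≤ 1)
    {y r : ℕ → H} (h : ∀ n, y (n + 2) = (2 : ℂ) • a (y (n + 1)) - y n + r n) {D : ℝ} {n : ℕ}
    (h0 : ‖y 0‖ ≤ D) (h1 : ‖y 1‖ ≤ D) (hr : ∀ j < n, ‖r j‖ ≤ D) :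
    ‖y n‖ ≤ 3 * D * (1 + n) ^ 2 := by
  have hD : 0 ≤ D := (norm_nonneg _).trans h0
  have hU : ∀ (k : ℕ) (x : H), ‖x‖ ≤ D →
      ‖aeval a (Chebyshev.U ℝ ((k : ℤ) - 1)) x‖ ≤ k * D := fun k x hx ↦
    (ContinuousLinearMap.le_of_opNorm_le _ (norm_aeval_chebyshev_U_le hsa ha k) x).trans
      (by gcongr)
  cases n with
  | zero => simp only [Nat.cast_zero]; linarith
  | succ n =>
    rw [chebyshev_recurrence_eq a n y r h]
    have hs : ‖∑ j ∈ Finset.range n, aeval a (Chebyshev.U ℝ (((n - j : ℕ) : ℤ) - 1)) (r j)‖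
        ≤ n * (n * D) := by
      refine (norm_sum_le _ _).trans ?_
      refine (Finset.sum_le_card_nsmul _ _ (n * D) fun j hj ↦ ?_).trans (by simp)
      refine (hU _ _ (hr j ((Finset.mem_range.1 hj).trans (Nat.lt_succ_self n)))).trans ?_
      gcongr
      omega
    have h3 := hU (n + 1) _ h1
    have h4 := hU n _ h0
    calc _ ≤ (n + 1 : ℕ) * D + n * D + n * (n * D) :=
          (norm_add_le _ _).trans (add_le_add ((norm_sub_le _ _).trans (add_le_add h3 h4)) hs)
      _ = D * (n ^ 2 + 2 * n + 1) := by push_cast; ring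
      _ ≤ D * (3 * (1 + ((n + 1 : ℕ) : ℝ)) ^ 2) := by
          gcongr
          push_cast
          have : (0 : ℝ) ≤ n := Nat.cast_nonneg n
          nlinarith
      _ = _ := by ring

/-- Solutions of a Chebyshev recurrence with bounded weighted data grow polynomially in every
weighted norm, uniformly in the weight. -/
theorem exists_norm_weightOp_recurrence_le {E : HilbertBasis ℕ ℂ H} {a : H →L[ℂ] H}
    (hsa : IsSelfAdjoint a) (ha : ‖a‖ ≤ 1) (hd : IsOffDiagDecaying E a) (B : ℕ → ℝ) (m : ℕ) :
    ∃ (C : ℝ) (M : ℕ), 0 ≤ C ∧ ∀ w, IsWeight w → ∀ y r : ℕ → H,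
      (∀ n, y (n + 2) = (2 : ℂ) • a (y (n + 1)) - y n + r n) →
      (∀ j, ‖weightOp E w j (y 0)‖ ≤ B j) → (∀ j, ‖weightOp E w j (y 1)‖ ≤ B j) →
      (∀ j n, ‖weightOp E w j (r n)‖ ≤ B j) →
      ∀ n : ℕ, ‖weightOp E w m (y n)‖ ≤ C * (1 + (n : ℝ)) ^ M := by
  induction m with
  | zero =>
    refine ⟨3 * |B 0|, 2, by positivity, fun w hw y r h h0 h1 hr n ↦ ?_⟩
    have h0 := (h0 0).trans (le_abs_self _)
    have h1 := (h1 0).trans (le_abs_self _)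
    have hr := fun n ↦ (hr 0 n).trans (le_abs_self _)
    simp only [weightOp_zero E hw] at h0 h1 hr ⊢
    exact norm_chebyshev_recurrence_le hsa ha h h0 h1 fun j _ ↦ hr j
  | succ m ih =>
    obtain ⟨C, M, hC, ih⟩ := ih
    obtain ⟨C', hC', hcomm⟩ := hd.exists_norm_commutator_le m
    refine ⟨3 * (2 * (C' * C) + |B (m + 1)|), M + 2, by positivity,
      fun w hw y r h h0 h1 hr n ↦ ?_⟩
    have ih := ih w hw y r h h0 h1 hr
    set W := weightOp E w (m + 1) with hW
    -- The weighted sequence solves the same recurrence; the new source is a commutator of order m,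
    -- controlled by the induction hypothesis.
    have h' : ∀ n, W (y (n + 2)) = (2 : ℂ) • a (W (y (n + 1))) - W (y n) +
        ((2 : ℂ) • (W (a (y (n + 1))) - a (W (y (n + 1)))) + W (r n)) := fun n ↦ by
      rw [h n, map_add, map_sub, map_smul, smul_sub]
      abel
    have hone : (1 : ℝ) ≤ (1 + (n : ℝ)) ^ M := one_le_pow₀ (by simp)
    have hle : |B (m + 1)| ≤ (2 * (C' * C) + |B (m + 1)|) * (1 + (n : ℝ)) ^ M :=
      (le_add_of_nonneg_left (by positivity)).trans (le_mul_of_one_le_right (by positivity) hone)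
    refine (norm_chebyshev_recurrence_le hsa ha (y := fun n ↦ W (y n))
      (D := (2 * (C' * C) + |B (m + 1)|) * (1 + (n : ℝ)) ^ M) h'
      (((h0 _).trans (le_abs_self _)).trans hle) (((h1 _).trans (le_abs_self _)).trans hle)
      fun j hj ↦ ?_).trans_eq (by ring)
    have hjn : (1 : ℝ) + ((j + 1 : ℕ) : ℝ) ≤ 1 + n := by
      gcongr; omega
    calc _ ≤ 2 * (C' * (C * (1 + ((j + 1 : ℕ) : ℝ)) ^ M)) + |B (m + 1)| := by
          refine (norm_add_le _ _).trans (add_le_add ?_ ((hr _ j).trans (le_abs_self _)))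
          rw [norm_smul, Complex.norm_ofNat]
          gcongr
          refine (hcomm w hw _).trans ?_
          gcongr
          exact ih _
      _ ≤ 2 * (C' * (C * (1 + (n : ℝ)) ^ M)) + |B (m + 1)| * (1 + (n : ℝ)) ^ M := by
          gcongr
          exact le_mul_of_one_le_right (abs_nonneg _) hone
      _ = _ := by ring

/-! ### Fourier coefficients of smooth functions -/

/-- Rapid decay of a two-sided sequence. -/
def IsRapidlyDecayingSeq (c : ℤ → ℂ) : Prop :=
  ∀ N : ℕ, ∃ C : ℝ, ∀ n : ℤ, (1 + |(n : ℝ)|) ^ N * ‖c n‖ ≤ C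

theorem IsRapidlyDecayingSeq.summable {c : ℤ → ℂ} (hc : IsRapidlyDecayingSeq c) (N : ℕ) :
    Summable fun n : ℤ ↦ (1 + |(n : ℝ)|) ^ N * ‖c n‖ := by
  obtain ⟨C, hC⟩ := hc (N + 2)
  refine Summable.of_nonneg_of_le (fun n ↦ by positivity) (fun n ↦ ?_)
    (summable_one_add_abs_sq_inv.mul_left C)
  rw [← div_eq_mul_inv, le_div_iff₀ (by positivity)]
  calc _ = (1 + |(n : ℝ)|) ^ (N + 2) * ‖c n‖ := by ring
    _ ≤ C := hC n

theorem IsRapidlyDecayingSeq.summable_norm {c : ℤ → ℂ} (hc : IsRapidlyDecayingSeq c) :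
    Summable fun n : ℤ ↦ ‖c n‖ := by
  simpa using hc.summable 0

/-- Each integration by parts gains a factor 1/n, the boundary terms cancelling by periodicity. -/
theorem exists_fourierCoeffOn_decay (N : ℕ) : ∀ f : ℝ → ℂ, ContDiff ℝ ∞ f →
    Function.Periodic f 1 → ∃ C : ℝ, ∀ n : ℤ,
      (1 + |(n : ℝ)|) ^ N * ‖fourierCoeffOn (zero_lt_one' ℝ) f n‖ ≤ C := by
  induction N with
  | zero =>
    intro f hf _
    obtain ⟨C, hC⟩ := isCompact_Icc.exists_bound_of_continuousOn (s := Set.Icc (0 : ℝ) 1)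
      hf.continuous.continuousOn
    refine ⟨C, fun n ↦ ?_⟩
    rw [pow_zero, one_mul, fourierCoeffOn_eq_integral]
    have h : ‖∫ x in (0 : ℝ)..1, fourier (-n) (x : AddCircle ((1 : ℝ) - 0)) • f x‖
        ≤ C * |1 - 0| := by
      refine intervalIntegral.norm_integral_le_of_norm_le_const fun x hx ↦ ?_
      rw [Set.uIoc_of_le zero_le_one] at hx
      rw [norm_smul, fourier_apply, Circle.norm_coe, one_mul]
      exact hC x ⟨hx.1.le, hx.2⟩
    simpa using h
  | succ N ih =>
    intro f hf hp
    have hd : ∀ x, HasDerivAt f (deriv f x) x := fun x ↦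
      (hf.differentiable (by simp) x).hasDerivAt
    have hf' : ContDiff ℝ ∞ (deriv f) := by
      exact ((contDiff_infty_iff_deriv).1 hf).2
    have hp' : Function.Periodic (deriv f) 1 := fun x ↦ by
      rw [← deriv_comp_add_const]
      congr 1
      exact funext hp
    obtain ⟨C, hC⟩ := ih _ hf' hp'
    -- Integration by parts says nothing about the coefficient at 0, which enters the constant
    -- separately.
    refine ⟨max C ‖fourierCoeffOn (zero_lt_one' ℝ) f 0‖, fun n ↦ ?_⟩
    rcases eq_or_ne n 0 with rfl | hn
    · simp
    · refine le_trans ?_ ((hC n).trans (le_max_left _ _))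
      have hn1 : (1 : ℝ) ≤ |(n : ℝ)| := by exact_mod_cast Int.one_le_abs hn
      have e : f 1 = f 0 := by simpa using hp 0
      rw [fourierCoeffOn_of_hasDerivAt (zero_lt_one' ℝ) hn (fun x _ ↦ hd x)
        (hf'.continuous.intervalIntegrable _ _), e, sub_self, mul_zero, zero_sub]
      simp only [norm_mul, norm_div, norm_neg, norm_one, Complex.norm_I, Complex.norm_intCast,
        Complex.norm_real, Complex.norm_ofNat, Real.norm_of_nonneg Real.pi_pos.le,
        Complex.ofReal_one, Complex.ofReal_zero, sub_zero, one_mul, mul_one]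
      have ht := norm_nonneg (fourierCoeffOn (zero_lt_one' ℝ) (deriv f) n)
      generalize ‖fourierCoeffOn (zero_lt_one' ℝ) (deriv f) n‖ = t at ht ⊢
      rw [pow_succ]
      have h2 : (1 + |(n : ℝ)|) * (1 / (2 * Real.pi * |(n : ℝ)|)) ≤ 1 := by
        rw [mul_one_div, div_le_one (by positivity)]
        nlinarith [Real.pi_gt_three]
      calc (1 + |(n : ℝ)|) ^ N * (1 + |(n : ℝ)|) * (1 / (2 * Real.pi * |(n : ℝ)|) * t)
          = (1 + |(n : ℝ)|) ^ N * ((1 + |(n : ℝ)|) * (1 / (2 * Real.pi * |(n : ℝ)|))) * t := by ring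
        _ ≤ (1 + |(n : ℝ)|) ^ N * 1 * t := by gcongr
        _ = _ := by ring

theorem fourierCoeff_eq_fourierCoeffOn (f : C(UnitAddCircle, ℂ)) (n : ℤ) :
    fourierCoeff f n = fourierCoeffOn (zero_lt_one' ℝ) (fun x : ℝ ↦ f (x : UnitAddCircle)) n := by
  rw [fourierCoeff_eq_intervalIntegral _ _ 0, fourierCoeffOn_eq_integral]
  simp only [zero_add, sub_zero]
  congr 1
  refine intervalIntegral.integral_congr fun x _ ↦ ?_
  simp

theorem IsSmoothSymbol.isRapidlyDecayingSeq {f : C(UnitAddCircle, ℂ)} (hf : IsSmoothSymbol f) :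
    IsRapidlyDecayingSeq (fun n ↦ fourierCoeff f n) := fun N ↦ by
  simp only [fourierCoeff_eq_fourierCoeffOn]
  refine exists_fourierCoeffOn_decay N _ hf fun x ↦ ?_
  simp

theorem iteratedDeriv_fourier (n : ℤ) (k : ℕ) :
    iteratedDeriv k (fun x : ℝ ↦ fourier n (x : UnitAddCircle)) =
      fun x : ℝ ↦ (2 * Real.pi * Complex.I * n) ^ k * fourier n (x : UnitAddCircle) := by
  induction k with
  | zero => simp
  | succ k ih =>
    rw [iteratedDeriv_succ, ih]
    ext x
    rw [((hasDerivAt_fourier 1 n x).const_mul _).deriv]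
    push_cast; ring

theorem contDiff_fourier (n : ℤ) : ContDiff ℝ ∞ (fun x : ℝ ↦ fourier n (x : UnitAddCircle)) := by
  have h : (fun x : ℝ ↦ fourier n (x : UnitAddCircle)) =
      fun x : ℝ ↦ Complex.exp (2 * Real.pi * Complex.I * n * x) := by
    ext x; simp
  rw [h]
  exact (contDiff_const.mul Complex.ofRealCLM.contDiff).cexp

/-- A rapidly decaying sequence is the sequence of Fourier coefficients of a smooth symbol. -/
theorem IsRapidlyDecayingSeq.exists_symbol {c : ℤ → ℂ} (hc : IsRapidlyDecayingSeq c) :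
    ∃ f : C(UnitAddCircle, ℂ), IsSmoothSymbol f ∧ ∀ n, fourierCoeff f n = c n := by
  have hs : Summable fun n : ℤ ↦ c n • (fourier n : C(UnitAddCircle, ℂ)) := by
    refine Summable.of_norm ?_
    simpa [norm_smul, fourier_norm] using hc.summable_norm
  refine ⟨∑' n : ℤ, c n • (fourier n : C(UnitAddCircle, ℂ)), ?_, fun m ↦ ?_⟩
  · have e : (fun x : ℝ ↦ (∑' n : ℤ, c n • (fourier n : C(UnitAddCircle, ℂ))) (x : UnitAddCircle))
        = fun x : ℝ ↦ ∑' n : ℤ, c n * fourier n (x : UnitAddCircle) := by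
      ext x
      rw [← ContinuousMap.tsum_apply hs]
      simp
    rw [IsSmoothSymbol, e]
    refine contDiff_tsum (v := fun k (n : ℤ) ↦ (2 * Real.pi) ^ k * ((1 + |(n : ℝ)|) ^ k * ‖c n‖))
      (fun n ↦ contDiff_const.mul (contDiff_fourier n)) (fun k _ ↦ (hc.summable k).mul_left _)
      fun k n x _ ↦ ?_
    rw [norm_iteratedFDeriv_eq_norm_iteratedDeriv,
      iteratedDeriv_const_mul_field, iteratedDeriv_fourier]
    simp only [norm_mul, norm_pow, Complex.norm_ofNat, Complex.norm_real, Complex.norm_I,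
      Complex.norm_intCast, Real.norm_of_nonneg Real.pi_pos.le, mul_one, fourier_apply,
      Circle.norm_coe]
    rw [mul_pow, mul_comm, mul_assoc]
    gcongr
    linarith
  · have h := (hs.hasSum.mapL (ContinuousMap.toLp 2 AddCircle.haarAddCircle ℂ)).mapL
      (innerSL ℂ (fourierLp (T := (1 : ℝ)) 2 m))
    have h2 : inner ℂ (fourierLp (T := (1 : ℝ)) 2 m) (ContinuousMap.toLp 2
        AddCircle.haarAddCircle ℂ (∑' n : ℤ, c n • (fourier n : C(UnitAddCircle, ℂ)))) =
        fourierCoeff (∑' n : ℤ, c n • (fourier n : C(UnitAddCircle, ℂ)) : C(UnitAddCircle, ℂ)) m := by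
      rw [← fourierCoeff_toLp, ← fourierBasis_repr, HilbertBasis.repr_apply_apply,
        coe_fourierBasis]
    rw [← h2]
    have e : ∀ n : ℤ, innerSL ℂ (fourierLp (T := (1 : ℝ)) 2 m)
        (ContinuousMap.toLp 2 AddCircle.haarAddCircle ℂ (c n • fourier n)) =
        if n = m then c m else 0 := fun n ↦ by
      have h1 : inner ℂ (fourierLp (T := (1 : ℝ)) 2 m) (fourierLp (T := (1 : ℝ)) 2 n) =
          if m = n then (1 : ℂ) else 0 :=
        orthonormal_iff_ite.1 (orthonormal_fourier (T := (1 : ℝ))) m n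
      rw [map_smul, map_smul, innerSL_apply_apply, smul_eq_mul]
      change c n * inner ℂ (fourierLp (T := (1 : ℝ)) 2 m) (fourierLp (T := (1 : ℝ)) 2 n) = _
      rw [h1]
      by_cases hnm : n = m
      · simp [hnm]
      · simp [hnm, Ne.symm hnm]
    rw [funext e] at h
    exact h.unique (hasSum_ite_eq m (c m))

/-- The matrix coefficients of a Toeplitz operator are the Fourier coefficients of the symbol. -/
theorem coeff_toeplitz (E : HilbertBasis ℕ ℂ H) (f : C(UnitAddCircle, ℂ)) (k l : ℕ) :
    coeff E (toeplitz E f) k l = fourierCoeff f ((k : ℤ) - l) := by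
  have hE : ∀ j : ℕ, (hardyEmbedding E).toContinuousLinearMap (E j) =
      fourierLp (T := (1 : ℝ)) 2 (j : ℤ) := fun j ↦
    basisIsometry_apply E
      ((orthonormal_fourier (T := (1 : ℝ))).comp (fun k : ℕ ↦ (k : ℤ)) Nat.cast_injective) j
  rw [coeff, toeplitz, ContinuousLinearMap.comp_apply, ContinuousLinearMap.comp_apply,
    ContinuousLinearMap.adjoint_inner_right, hE, hE, L2.inner_def, fourierCoeff]
  refine integral_congr_ae ?_
  have h1 := (ContinuousLinearMap.mul ℂ ℂ).coeFn_holder (r := 2)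
    (ContinuousMap.toLp ∞ AddCircle.haarAddCircle ℂ f) (fourierLp (T := (1 : ℝ)) 2 (l : ℤ))
  filter_upwards [h1, coeFn_fourierLp (T := (1 : ℝ)) 2 (l : ℤ),
    coeFn_fourierLp (T := (1 : ℝ)) 2 (k : ℤ),
    ContinuousMap.coeFn_toLp (p := ∞) (𝕜 := ℂ) AddCircle.haarAddCircle f] with x hx hl hk hf
  rw [mulOp, ContinuousLinearMap.holderL_apply_apply, hx, hl, hk, hf]
  simp only [ContinuousLinearMap.mul_apply', RCLike.inner_apply]
  rw [neg_sub, sub_eq_add_neg, fourier_add, fourier_neg, smul_eq_mul]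
  ring

/-- The Chebyshev expansion of a smooth function on `[-1, 1]`. -/
theorem exists_hasSum_chebyshev {F : ℝ → ℂ} (hF : ContDiff ℝ ∞ F) :
    ∃ c : ℤ → ℂ, IsRapidlyDecayingSeq c ∧ ∀ x : ℝ, |x| ≤ 1 →
      HasSum (fun n ↦ c n * (((Polynomial.Chebyshev.T ℝ n).eval x : ℝ) : ℂ)) (F x) := by
  -- In the variable x = cos 2πt the Chebyshev series of F is the Fourier series of h.
  set h : ℝ → ℂ := fun t ↦ F (Real.cos (2 * Real.pi * t)) with hh
  have hs : ContDiff ℝ ∞ h :=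
    hF.comp (Real.contDiff_cos.comp (contDiff_const.mul contDiff_id))
  have hp : Function.Periodic h 1 := fun t ↦ by
    simp only [hh]
    rw [mul_add, mul_one, Real.cos_add_two_pi]
  let f : C(UnitAddCircle, ℂ) := ⟨hp.lift,
    continuous_coinduced_dom.2 hs.continuous⟩
  have hf : ∀ t : ℝ, f (t : UnitAddCircle) = h t := fun t ↦ rfl
  have hfs : IsSmoothSymbol f := hs
  have hc := hfs.isRapidlyDecayingSeq
  refine ⟨_, hc, fun x hx ↦ ?_⟩
  have hsum : Summable (fourierCoeff f) := hc.summable_norm.of_norm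
  set t := Real.arccos x / (2 * Real.pi) with ht
  have hx' : Real.cos (2 * Real.pi * t) = x := by
    rw [ht, mul_div_cancel₀ _ (by positivity), Real.cos_arccos (abs_le.1 hx).1 (abs_le.1 hx).2]
  have h1 := has_pointwise_sum_fourier_series_of_summable hsum (t : UnitAddCircle)
  have h2 := has_pointwise_sum_fourier_series_of_summable hsum ((-t : ℝ) : UnitAddCircle)
  -- Averaging over t and -t turns exponentials into cosines, with no need for symmetry of the
  -- coefficients.
  have h3 := (h1.add h2).mul_left (1 / 2 : ℂ)
  rw [hf, hf] at h3
  have e1 : ∀ n : ℤ, fourierCoeff f n * (((Polynomial.Chebyshev.T ℝ n).eval x : ℝ) : ℂ) =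
      1 / 2 * (fourierCoeff f n • fourier n (t : UnitAddCircle) +
        fourierCoeff f n • fourier n ((-t : ℝ) : UnitAddCircle)) := fun n ↦ by
    rw [← hx', Polynomial.Chebyshev.T_real_cos, fourier_coe_apply, fourier_coe_apply,
      Complex.ofReal_cos, Complex.cos, smul_eq_mul, smul_eq_mul]
    push_cast
    rw [show (n : ℂ) * (2 * Real.pi * t) * Complex.I = 2 * Real.pi * Complex.I * n * t / 1 by ring,
      show -((n : ℂ) * (2 * Real.pi * t)) * Complex.I = 2 * Real.pi * Complex.I * n * -t / 1 by
        ring]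
    ring
  have e2 : F x = 1 / 2 * (h t + h (-t)) := by
    simp only [hh, mul_neg, Real.cos_neg, hx']
    ring
  rw [funext e1, e2]
  exact h3

/-! ### A characterisation of the smooth Toeplitz algebra -/

/-- The commutator `U* b - b U*` with the backward shift. -/
def shiftComm (E : HilbertBasis ℕ ℂ H) (b : H →L[ℂ] H) : H →L[ℂ] H :=
  (shift E).adjoint ∘L b - b ∘L (shift E).adjoint

theorem inner_adjoint_shift (E : HilbertBasis ℕ ℂ H) (k : ℕ) (x : H) :
    inner ℂ (E k) ((shift E).adjoint x) = inner ℂ (E (k + 1)) x := by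
  rw [ContinuousLinearMap.adjoint_inner_right, shift_apply]

theorem adjoint_shift_zero (E : HilbertBasis ℕ ℂ H) : (shift E).adjoint (E 0) = 0 :=
  ext_inner_basis E fun k ↦ by
    rw [inner_adjoint_shift, orthonormal_iff_ite.1 E.orthonormal, inner_zero_right]
    simp

theorem adjoint_shift_succ (E : HilbertBasis ℕ ℂ H) (l : ℕ) :
    (shift E).adjoint (E (l + 1)) = E l :=
  ext_inner_basis E fun k ↦ by
    rw [inner_adjoint_shift, orthonormal_iff_ite.1 E.orthonormal,
      orthonormal_iff_ite.1 E.orthonormal]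
    simp

theorem coeff_shiftComm_zero (E : HilbertBasis ℕ ℂ H) (b : H →L[ℂ] H) (k : ℕ) :
    coeff E (shiftComm E b) k 0 = coeff E b (k + 1) 0 := by
  simp [coeff, shiftComm, inner_adjoint_shift, adjoint_shift_zero]

/-- A Toeplitz matrix is constant along diagonals and cancels here; only column zero still sees it.
-/
theorem coeff_shiftComm_succ (E : HilbertBasis ℕ ℂ H) (b : H →L[ℂ] H) (k l : ℕ) :
    coeff E (shiftComm E b) k (l + 1) = coeff E b (k + 1) (l + 1) - coeff E b k l := by
  simp [coeff, shiftComm, inner_adjoint_shift, adjoint_shift_succ]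

omit [CompleteSpace H] in
theorem coeff_matrixUnit (E : HilbertBasis ℕ ℂ H) (i j k l : ℕ) :
    coeff E (matrixUnit E i j) k l = if (i, j) = (k, l) then 1 else 0 := by
  simp only [coeff, matrixUnit, InnerProductSpace.rankOne_apply, inner_smul_right,
    orthonormal_iff_ite.1 E.orthonormal, Prod.mk.injEq]
  by_cases h1 : i = k <;> by_cases h2 : j = l <;> simp [h1, h2, eq_comm (a := k)]

/-- Matrix coefficients as continuous linear functionals. -/
def coeffCLM (E : HilbertBasis ℕ ℂ H) (k l : ℕ) : (H →L[ℂ] H) →L[ℂ] ℂ :=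
  innerSL ℂ (E k) ∘L ContinuousLinearMap.apply ℂ H (E l)

omit [CompleteSpace H] in
theorem coeffCLM_apply (E : HilbertBasis ℕ ℂ H) (k l : ℕ) (a : H →L[ℂ] H) :
    coeffCLM E k l a = coeff E a k l := rfl

omit [CompleteSpace H] in
theorem coeff_add (E : HilbertBasis ℕ ℂ H) (a b : H →L[ℂ] H) (k l : ℕ) :
    coeff E (a + b) k l = coeff E a k l + coeff E b k l := map_add (coeffCLM E k l) a b

omit [CompleteSpace H] in
theorem coeff_smul (E : HilbertBasis ℕ ℂ H) (s : ℂ) (a : H →L[ℂ] H) (k l : ℕ) :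
    coeff E (s • a) k l = s * coeff E a k l := map_smul (coeffCLM E k l) s a

omit [CompleteSpace H] in
theorem coeff_of_hasSum (E : HilbertBasis ℕ ℂ H) {c : ℕ → ℕ → ℂ} {a : H →L[ℂ] H}
    (h : HasSum (fun p : ℕ × ℕ ↦ c p.1 p.2 • matrixUnit E p.1 p.2) a) (k l : ℕ) :
    coeff E a k l = c k l := by
  have h1 := h.mapL (coeffCLM E k l)
  have e : ∀ p : ℕ × ℕ, coeffCLM E k l (c p.1 p.2 • matrixUnit E p.1 p.2) =
      if p = (k, l) then c k l else 0 := fun p ↦ by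
    rw [map_smul, coeffCLM_apply, coeff_matrixUnit, smul_eq_mul]
    split_ifs with hp
    · simp [← (Prod.mk.inj hp).1, ← (Prod.mk.inj hp).2]
    · simp
  rw [funext e] at h1
  exact h1.unique (hasSum_ite_eq (k, l) (c k l))

theorem abs_natCast_sub_le (k l : ℕ) : |(k : ℝ) - l| ≤ k + l := by
  rw [abs_le]
  constructor <;> linarith [k.cast_nonneg (α := ℝ), l.cast_nonneg (α := ℝ)]

theorem isOffDiagDecaying_toeplitz_add (E : HilbertBasis ℕ ℂ H) {f : C(UnitAddCircle, ℂ)}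
    (hf : IsSmoothSymbol f) {c : H →L[ℂ] H} (hc : IsSmoothCompact E c) :
    IsOffDiagDecaying E (toeplitz E f + c) := by
  obtain ⟨c', hc', hs⟩ := hc
  intro N
  obtain ⟨C₁, h₁⟩ := hf.isRapidlyDecayingSeq N
  obtain ⟨C₂, h₂⟩ := hc' N
  refine ⟨C₁ + C₂, fun k l ↦ ?_⟩
  rw [coeff_add, coeff_toeplitz, coeff_of_hasSum E hs]
  have h₁ := h₁ ((k : ℤ) - l)
  push_cast at h₁
  calc _ ≤ (1 + |(k : ℝ) - l|) ^ N * (‖fourierCoeff f ((k : ℤ) - l)‖ + ‖c' k l‖) := by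
        gcongr; exact norm_add_le _ _
    _ = (1 + |(k : ℝ) - l|) ^ N * ‖fourierCoeff f ((k : ℤ) - l)‖ +
        (1 + |(k : ℝ) - l|) ^ N * ‖c' k l‖ := mul_add _ _ _
    _ ≤ C₁ + (1 + k + l) ^ N * ‖c' k l‖ := by
        have := abs_natCast_sub_le k l
        rw [add_assoc (1 : ℝ)]
        gcongr
    _ ≤ C₁ + C₂ := by gcongr; exact h₂ k l

theorem isRapidlyDecaying_shiftComm_toeplitz_add (E : HilbertBasis ℕ ℂ H)
    {f : C(UnitAddCircle, ℂ)} (hf : IsSmoothSymbol f) {c : H →L[ℂ] H} (hc : IsSmoothCompact E c) :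
    IsRapidlyDecaying (coeff E (shiftComm E (toeplitz E f + c))) := by
  have hd := isOffDiagDecaying_toeplitz_add E hf hc
  obtain ⟨c', hc', hs⟩ := hc
  intro N
  obtain ⟨C₁, h₁⟩ := hd N
  obtain ⟨C₂, h₂⟩ := hc' N
  -- C₁ serves column zero, by off-diagonal decay. In the other columns 1 + k + (l + 1) ≤ 2(1 + k +
  -- l) produces the 2 ^ N.
  refine ⟨max C₁ (C₂ + 2 ^ N * C₂), fun k l ↦ ?_⟩
  cases l with
  | zero =>
    refine le_trans ?_ (le_max_left _ _)
    rw [coeff_shiftComm_zero]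
    refine le_trans ?_ (h₁ (k + 1) 0)
    have : |((k + 1 : ℕ) : ℝ) - (0 : ℕ)| = k + 1 := by
      push_cast; rw [sub_zero, abs_of_nonneg (by positivity)]
    rw [this, Nat.cast_zero, add_zero]
    gcongr
    linarith
  | succ l =>
    refine le_trans ?_ (le_max_right _ _)
    have e : coeff E (shiftComm E (toeplitz E f + c)) k (l + 1) = c' (k + 1) (l + 1) - c' k l := by
      rw [coeff_shiftComm_succ, coeff_add, coeff_add, coeff_toeplitz, coeff_toeplitz,
        coeff_of_hasSum E hs, coeff_of_hasSum E hs]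
      push_cast
      rw [add_sub_add_right_eq_sub, add_sub_add_left_eq_sub]
    rw [e]
    have hk : (0 : ℝ) ≤ k := k.cast_nonneg
    have hl : (0 : ℝ) ≤ l := l.cast_nonneg
    calc _ ≤ (1 + (k : ℝ) + (l + 1 : ℕ)) ^ N * (‖c' (k + 1) (l + 1)‖ + ‖c' k l‖) := by
          gcongr; exact norm_sub_le _ _
      _ = (1 + (k : ℝ) + (l + 1 : ℕ)) ^ N * ‖c' (k + 1) (l + 1)‖ +
          (1 + (k : ℝ) + (l + 1 : ℕ)) ^ N * ‖c' k l‖ := mul_add _ _ _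
      _ ≤ (1 + ((k + 1 : ℕ) : ℝ) + (l + 1 : ℕ)) ^ N * ‖c' (k + 1) (l + 1)‖ +
          (2 * (1 + (k : ℝ) + l)) ^ N * ‖c' k l‖ := by
          gcongr
          · omega
          · push_cast; linarith
      _ = (1 + ((k + 1 : ℕ) : ℝ) + (l + 1 : ℕ)) ^ N * ‖c' (k + 1) (l + 1)‖ +
          2 ^ N * ((1 + (k : ℝ) + l) ^ N * ‖c' k l‖) := by rw [mul_pow]; ring
      _ ≤ C₂ + 2 ^ N * C₂ := by
          gcongr
          · exact h₂ (k + 1) (l + 1)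
          · exact h₂ k l

theorem IsRapidlyDecaying.exists_isSmoothCompact (E : HilbertBasis ℕ ℂ H)
    {c : ℕ → ℕ → ℂ} (hc : IsRapidlyDecaying c) :
    ∃ a, IsSmoothCompact E a ∧ ∀ k l, coeff E a k l = c k l := by
  have hs : Summable fun p : ℕ × ℕ ↦ c p.1 p.2 • matrixUnit E p.1 p.2 := by
    obtain ⟨C, hC⟩ := hc 4
    refine Summable.of_norm_bounded
      (g := fun p : ℕ × ℕ ↦ C * (((1 + (p.1 : ℝ)) ^ 2)⁻¹ * ((1 + (p.2 : ℝ)) ^ 2)⁻¹))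
      ((summable_one_add_sq_inv.mul_of_nonneg summable_one_add_sq_inv
        (fun _ ↦ by positivity) (fun _ ↦ by positivity)).mul_left C) fun p ↦ ?_
    rw [norm_smul, matrixUnit, InnerProductSpace.norm_rankOne, E.orthonormal.1, E.orthonormal.1,
      mul_one, mul_one, ← mul_inv, ← div_eq_mul_inv, le_div_iff₀ (by positivity), mul_comm]
    refine le_trans ?_ (hC p.1 p.2)
    have h1 : (0 : ℝ) ≤ p.1 := p.1.cast_nonneg
    have h2 : (0 : ℝ) ≤ p.2 := p.2.cast_nonneg
    calc (1 + (p.1 : ℝ)) ^ 2 * (1 + (p.2 : ℝ)) ^ 2 * ‖c p.1 p.2‖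
        ≤ (1 + (p.1 : ℝ) + p.2) ^ 2 * (1 + (p.1 : ℝ) + p.2) ^ 2 * ‖c p.1 p.2‖ := by
          gcongr ?_ ^ 2 * ?_ ^ 2 * _ <;> linarith
      _ = _ := by ring
  exact ⟨_, ⟨c, hc, hs.hasSum⟩, coeff_of_hasSum E hs.hasSum⟩

/-- A rapidly decaying double sequence is a difference along the diagonals of one. -/
theorem IsRapidlyDecaying.exists_diagonal_primitive {d : ℕ → ℕ → ℂ} (hd : IsRapidlyDecaying d) :
    ∃ c : ℕ → ℕ → ℂ, IsRapidlyDecaying c ∧ ∀ k l, c (k + 1) (l + 1) = c k l + d k l := by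
  have hb : ∀ N : ℕ, ∃ C : ℝ, ∀ k l j : ℕ, (1 + (k : ℝ) + l) ^ N * ‖d (k + j) (l + j)‖ ≤
      C * ((1 + (j : ℝ)) ^ 2)⁻¹ := fun N ↦ by
    -- Two extra orders of decay pay for the summation over j.
    obtain ⟨C, hC⟩ := hd (N + 2)
    refine ⟨C, fun k l j ↦ ?_⟩
    rw [← div_eq_mul_inv, le_div_iff₀ (by positivity)]
    refine le_trans ?_ (hC (k + j) (l + j))
    have hk : (0 : ℝ) ≤ k := k.cast_nonneg
    have hl : (0 : ℝ) ≤ l := l.cast_nonneg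
    have hj : (0 : ℝ) ≤ j := j.cast_nonneg
    rw [pow_add, mul_right_comm]
    push_cast
    gcongr ?_ ^ N * ?_ ^ 2 * _ <;> linarith
  have hs : ∀ k l, Summable fun j ↦ d (k + j) (l + j) := fun k l ↦ by
    obtain ⟨C, hC⟩ := hb 0
    exact Summable.of_norm_bounded (summable_one_add_sq_inv.mul_left C)
      fun j ↦ by simpa using hC k l j
  -- Summing from (k, l) out to infinity, rather than from the boundary, makes the primitive decay.
  refine ⟨fun k l ↦ -∑' j, d (k + j) (l + j), fun N ↦ ?_, fun k l ↦ ?_⟩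
  · obtain ⟨C, hC⟩ := hb N
    refine ⟨∑' j : ℕ, C * ((1 + (j : ℝ)) ^ 2)⁻¹, fun k l ↦ ?_⟩
    rw [norm_neg]
    have h : ‖(((1 + (k : ℝ) + l) ^ N : ℝ) : ℂ) * ∑' j, d (k + j) (l + j)‖ ≤
        ∑' j : ℕ, C * ((1 + (j : ℝ)) ^ 2)⁻¹ := by
      rw [← tsum_mul_left]
      refine tsum_of_norm_bounded (summable_one_add_sq_inv.mul_left C).hasSum fun j ↦ ?_
      rw [norm_mul, Complex.norm_real, Real.norm_of_nonneg (by positivity)]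
      exact hC k l j
    rwa [norm_mul, Complex.norm_real, Real.norm_of_nonneg (by positivity)] at h
  · beta_reduce
    rw [(hs k l).tsum_eq_zero_add]
    have : ∀ j, d (k + 1 + j) (l + 1 + j) = d (k + (j + 1)) (l + (j + 1)) := fun j ↦ by
      congr 1 <;> omega
    simp only [this, add_zero]
    ring

/-- An operator with off-diagonal decay whose commutator with the backward shift decays rapidly
is the sum of a smooth Toeplitz operator and a smooth compact operator. -/
theorem exists_eq_toeplitz_add (E : HilbertBasis ℕ ℂ H) {b : H →L[ℂ] H}
    (hb : IsOffDiagDecaying E b)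
    (hc : ∀ N : ℕ, ∃ C : ℝ, ∀ k l : ℕ, (1 + (k : ℝ)) ^ N * ‖coeff E (shiftComm E b) k l‖ ≤ C) :
    ∃ (f : C(UnitAddCircle, ℂ)) (c : H →L[ℂ] H), IsSmoothSymbol f ∧ IsSmoothCompact E c ∧
      b = toeplitz E f + c := by
  have hd : IsRapidlyDecaying fun k l ↦ coeff E b (k + 1) (l + 1) - coeff E b k l := by
    intro N
    obtain ⟨C₁, h₁⟩ := hb N
    obtain ⟨C₂, h₂⟩ := hc N
    refine ⟨3 ^ N * max (C₁ + C₁) C₂, fun k l ↦ ?_⟩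
    have hk : (0 : ℝ) ≤ k := k.cast_nonneg
    set t := ‖coeff E b (k + 1) (l + 1) - coeff E b k l‖ with ht
    have ht1 : (1 + |(k : ℝ) - l|) ^ N * t ≤ max (C₁ + C₁) C₂ := by
      refine le_trans ?_ (le_max_left _ _)
      have h3 := h₁ (k + 1) (l + 1)
      push_cast at h3
      rw [add_sub_add_right_eq_sub] at h3
      calc _ ≤ (1 + |(k : ℝ) - l|) ^ N * (‖coeff E b (k + 1) (l + 1)‖ + ‖coeff E b k l‖) := by
            gcongr; exact norm_sub_le _ _
        _ ≤ C₁ + C₁ := by rw [mul_add]; exact add_le_add h3 (h₁ k l)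
    have ht2 : (1 + (k : ℝ)) ^ N * t ≤ max (C₁ + C₁) C₂ := by
      refine le_trans ?_ (le_max_right _ _)
      rw [ht, ← coeff_shiftComm_succ]
      exact h₂ k (l + 1)
    have hle : (l : ℝ) ≤ k + |(k : ℝ) - l| := by linarith [neg_abs_le ((k : ℝ) - l)]
    have ha := abs_nonneg ((k : ℝ) - l)
    -- Since l ≤ k + |k - l|, the larger of 1 + k and 1 + |k - l| is at least a third of 1 + k + l.
    rcases le_total (1 + (k : ℝ)) (1 + |(k : ℝ) - l|) with h | h
    · calc (1 + (k : ℝ) + l) ^ N * t ≤ (3 * (1 + |(k : ℝ) - l|)) ^ N * t := by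
            gcongr; linarith
        _ = 3 ^ N * ((1 + |(k : ℝ) - l|) ^ N * t) := by rw [mul_pow, mul_assoc]
        _ ≤ _ := by gcongr
    · calc (1 + (k : ℝ) + l) ^ N * t ≤ (3 * (1 + (k : ℝ))) ^ N * t := by
            gcongr; linarith
        _ = 3 ^ N * ((1 + (k : ℝ)) ^ N * t) := by rw [mul_pow, mul_assoc]
        _ ≤ _ := by gcongr
  obtain ⟨c, hcr, hcd⟩ := hd.exists_diagonal_primitive
  set t : ℕ → ℕ → ℂ := fun k l ↦ coeff E b k l - c k l with ht
  have ht1 : ∀ k l j : ℕ, t (k + j) (l + j) = t k l := fun k l j ↦ by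
    induction j with
    | zero => rfl
    | succ j ih => rw [← ih, ht]; simp only [← add_assoc, hcd]; ring
  -- Each diagonal n is represented by its point (n⁺, n⁻) on the boundary of the quadrant.
  have htg : ∀ k l : ℕ, t k l = t ((k : ℤ) - l).toNat (-((k : ℤ) - l)).toNat := fun k l ↦ by
    rw [← ht1 ((k : ℤ) - l).toNat (-((k : ℤ) - l)).toNat (min k l)]
    congr 1 <;> omega
  have hg : IsRapidlyDecayingSeq fun n ↦ t n.toNat (-n).toNat := by
    intro N
    obtain ⟨C₁, h₁⟩ := hb N
    obtain ⟨C₂, h₂⟩ := hcr N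
    refine ⟨C₁ + C₂, fun n ↦ ?_⟩
    have e1 : |(n : ℝ)| = |(n.toNat : ℝ) - (-n).toNat| := by
      congr 1
      have : n = (n.toNat : ℤ) - (-n).toNat := by omega
      exact_mod_cast this
    rw [e1]
    beta_reduce
    generalize n.toNat = k
    generalize (-n).toNat = l
    calc (1 + |(k : ℝ) - l|) ^ N * ‖coeff E b k l - c k l‖
        ≤ (1 + |(k : ℝ) - l|) ^ N * (‖coeff E b k l‖ + ‖c k l‖) := by
          gcongr; exact norm_sub_le _ _
      _ = (1 + |(k : ℝ) - l|) ^ N * ‖coeff E b k l‖ +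
          (1 + |(k : ℝ) - l|) ^ N * ‖c k l‖ := mul_add _ _ _
      _ ≤ C₁ + (1 + k + l) ^ N * ‖c k l‖ := by
          have := abs_natCast_sub_le k l
          rw [add_assoc (1 : ℝ)]
          gcongr
          exact h₁ k l
      _ ≤ C₁ + C₂ := by gcongr; exact h₂ k l
  obtain ⟨f, hf, hfc⟩ := hg.exists_symbol
  obtain ⟨a, ha, hac⟩ := hcr.exists_isSmoothCompact E
  refine ⟨f, a, hf, ha, ext_coeff E fun k l ↦ ?_⟩
  rw [coeff_add, coeff_toeplitz, hfc, hac, ← htg, ht, sub_add_cancel]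

/-! ### Chebyshev polynomials of a smooth element -/

omit [CompleteSpace H] in
theorem aeval_chebyshev_T_add_two (a : H →L[ℂ] H) (n : ℕ) :
    aeval a (Chebyshev.T ℝ ((n + 2 : ℕ) : ℤ)) =
      (2 : ℂ) • (a * aeval a (Chebyshev.T ℝ ((n + 1 : ℕ) : ℤ)))
        - aeval a (Chebyshev.T ℝ (n : ℤ)) := by
  push_cast
  rw [Chebyshev.T_add_two, map_sub, map_mul, map_mul, aeval_X, map_ofNat, two_smul, ← two_mul,
    mul_assoc]

theorem exists_coeff_chebyshev_le {E : HilbertBasis ℕ ℂ H} {a : H →L[ℂ] H}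
    (hsa : IsSelfAdjoint a) (ha : ‖a‖ ≤ 1) (hd : IsOffDiagDecaying E a) (m : ℕ) :
    ∃ (C : ℝ) (M : ℕ), ∀ n k l : ℕ, (1 + |(k : ℝ) - l|) ^ m *
      ‖coeff E (aeval a (Chebyshev.T ℝ (n : ℤ))) k l‖ ≤ C * (1 + (n : ℝ)) ^ M := by
  choose B hB using hd.exists_norm_weightOp_le
  obtain ⟨C, M, -, h⟩ := exists_norm_weightOp_recurrence_le hsa ha hd (fun j ↦ max 1 (B j)) m
  refine ⟨C, M, fun n k l ↦ ?_⟩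
  -- As |k - l| ≤ k + l, the truncation is not felt at k.
  have hw := isWeight_truncWeight l (k + l)
  have h1 := h _ hw (fun n ↦ aeval a (Chebyshev.T ℝ (n : ℤ)) (E l)) 0 (fun n ↦ ?_) (fun j ↦ ?_)
    (fun j ↦ ?_) (fun j n ↦ ?_) n
  · refine le_trans (le_of_eq ?_) ((mul_norm_inner_le E hw m k _).trans h1)
    have : truncWeight l (k + l) k = 1 + |(k : ℝ) - l| := by
      refine min_eq_left ?_
      push_cast
      linarith [abs_natCast_sub_le k l]
    rw [this, coeff]
  · simp only [aeval_chebyshev_T_add_two, sub_apply, smul_apply, mul_apply_eq_comp,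
      Pi.zero_apply, add_zero]
  · simp only [Nat.cast_zero, Chebyshev.T_zero, map_one, one_apply_eq_self]
    have hwl : truncWeight l (k + l) l = 1 :=
      (min_eq_left (by simp; positivity)).trans (by simp)
    rw [weightOp_basis E hw, norm_smul, E.orthonormal.1, hwl]
    simp
  · simp only [Nat.cast_one, Chebyshev.T_one, aeval_X]
    exact (hB j l (k + l)).trans (le_max_right _ _)
  · simp only [Pi.zero_apply, map_zero, norm_zero]
    exact zero_le_one.trans (le_max_left _ _)

/-- The derivation property gives δ(Tₙ(a)) a Chebyshev recurrence with source 2δ(a)T_{n+1}(a). -/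
theorem shiftComm_mul (E : HilbertBasis ℕ ℂ H) (a b : H →L[ℂ] H) :
    shiftComm E (a * b) = shiftComm E a * b + a * shiftComm E b := by
  ext x
  simp [shiftComm]

/-- Weights centred at 0 measure decay in the row index alone. The source stays bounded in every
weighted norm because δ(a) absorbs the weight and ‖Tₙ(a)‖ ≤ 1. -/
theorem exists_coeff_shiftComm_chebyshev_le {E : HilbertBasis ℕ ℂ H} {a : H →L[ℂ] H}
    (hsa : IsSelfAdjoint a) (ha : ‖a‖ ≤ 1) (hd : IsOffDiagDecaying E a)
    (hs : IsRapidlyDecaying (coeff E (shiftComm E a))) (m : ℕ) :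
    ∃ (C : ℝ) (M : ℕ), ∀ n k l : ℕ, (1 + (k : ℝ)) ^ m *
      ‖coeff E (shiftComm E (aeval a (Chebyshev.T ℝ (n : ℤ)))) k l‖ ≤ C * (1 + (n : ℝ)) ^ M := by
  have hB : ∀ j : ℕ, ∃ B : ℝ, ∀ R x,
      ‖weightOp E (truncWeight 0 R) j (shiftComm E a x)‖ ≤ B * ‖x‖ := fun j ↦ by
    obtain ⟨B, hB⟩ := hs (j + 2)
    refine ⟨B * (2 * schurSum), fun R x ↦ ContinuousLinearMap.le_of_opNorm_le
      (weightOp E (truncWeight 0 R) j ∘L shiftComm E a) (norm_le_of_coeff_le E _ fun k l ↦ ?_) x⟩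
    have hw := isWeight_truncWeight 0 R
    refine le_trans ?_ (hB k l)
    have hk : (0 : ℝ) ≤ k := k.cast_nonneg
    have hl : (0 : ℝ) ≤ l := l.cast_nonneg
    have h1 : truncWeight 0 R k ≤ 1 + k + l := by
      refine (min_le_left _ _).trans ?_
      rw [Nat.cast_zero, sub_zero, abs_of_nonneg hk]
      linarith
    have h2 : 1 + |(k : ℝ) - l| ≤ 1 + k + l := by linarith [abs_natCast_sub_le k l]
    have h3 := (hw.pos k).le
    rw [coeff, ContinuousLinearMap.comp_apply, inner_weightOp E hw, norm_mul, norm_pow,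
      Complex.norm_real, Real.norm_of_nonneg h3, pow_add, mul_comm ((1 + (k : ℝ) + l) ^ j),
      mul_assoc, coeff]
    gcongr
  choose B hB using hB
  obtain ⟨C, M, -, h⟩ := exists_norm_weightOp_recurrence_le hsa ha hd (fun j ↦ 2 * |B j|) m
  refine ⟨C, M, fun n k l ↦ ?_⟩
  have hw := isWeight_truncWeight 0 k
  have h1 := h _ hw (fun n ↦ shiftComm E (aeval a (Chebyshev.T ℝ (n : ℤ))) (E l))
    (fun n ↦ (2 : ℂ) • shiftComm E a (aeval a (Chebyshev.T ℝ ((n + 1 : ℕ) : ℤ)) (E l)))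
    (fun n ↦ ?_) (fun j ↦ ?_) (fun j ↦ ?_) (fun j n ↦ ?_) n
  · refine le_trans (le_of_eq ?_) ((mul_norm_inner_le E hw m k _).trans h1)
    have : truncWeight 0 k k = 1 + k := by
      simp [truncWeight, add_comm]
    rw [this, coeff]
  · have e : ∀ b c : H →L[ℂ] H, shiftComm E ((2 : ℂ) • (a * b) - c) =
        (2 : ℂ) • (shiftComm E a * b + a * shiftComm E b) - shiftComm E c := fun b c ↦ by
      rw [← shiftComm_mul]
      ext x
      simp [shiftComm, smul_sub]
      abel
    simp only [aeval_chebyshev_T_add_two, e, sub_apply, smul_apply, add_apply,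
      mul_apply_eq_comp, smul_add]
    abel
  · simp [shiftComm]
  · simp only [Nat.cast_one, Chebyshev.T_one, aeval_X]
    refine (hB j k (E l)).trans ?_
    rw [E.orthonormal.1, mul_one]
    linarith [le_abs_self (B j), abs_nonneg (B j)]
  · rw [map_smul, norm_smul, Complex.norm_ofNat]
    gcongr
    refine (hB j k _).trans ?_
    have h1 : ‖aeval a (Chebyshev.T ℝ ((n + 1 : ℕ) : ℤ)) (E l)‖ ≤ 1 := by
      simpa [E.orthonormal.1] using
        ContinuousLinearMap.le_of_opNorm_le _ (norm_aeval_chebyshev_T_le hsa ha _) (E l)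
    calc _ ≤ |B j| * 1 := by
          gcongr
          exact le_abs_self _
      _ = _ := mul_one _

/-! ### The smooth functional calculus -/

/-- Rapid decay beats polynomial growth; D is chosen before z, s and t, hence is uniform over matrix
entries. -/
theorem exists_mul_norm_le_of_hasSum {c : ℤ → ℂ} (hc : IsRapidlyDecayingSeq c) (C : ℝ) (M : ℕ) :
    ∃ D : ℝ, ∀ (z : ℤ → ℂ) (s : ℂ) (t : ℝ), 0 ≤ t → HasSum (fun n ↦ c n * z n) s →
      (∀ n, t * ‖z n‖ ≤ C * (1 + |(n : ℝ)|) ^ M) → t * ‖s‖ ≤ D := by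
  refine ⟨∑' n : ℤ, C * ((1 + |(n : ℝ)|) ^ M * ‖c n‖), fun z s t ht hs h ↦ ?_⟩
  have h1 : ‖∑' n, (t : ℂ) * (c n * z n)‖ ≤ ∑' n : ℤ, C * ((1 + |(n : ℝ)|) ^ M * ‖c n‖) := by
    refine tsum_of_norm_bounded ((hc.summable M).mul_left C).hasSum fun n ↦ ?_
    rw [norm_mul, norm_mul, Complex.norm_real, Real.norm_of_nonneg ht]
    calc _ = (t * ‖z n‖) * ‖c n‖ := by ring
      _ ≤ (C * (1 + |(n : ℝ)|) ^ M) * ‖c n‖ := mul_le_mul_of_nonneg_right (h n) (norm_nonneg _)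
      _ = _ := by ring
  rwa [tsum_mul_left, hs.tsum_eq, norm_mul, Complex.norm_real, Real.norm_of_nonneg ht] at h1

/-- The shift commutator as a continuous linear map. -/
def shiftCommCLM (E : HilbertBasis ℕ ℂ H) : (H →L[ℂ] H) →L[ℂ] (H →L[ℂ] H) :=
  ContinuousLinearMap.compL ℂ H H H (shift E).adjoint -
    (ContinuousLinearMap.compL ℂ H H H).flip (shift E).adjoint

theorem shiftCommCLM_apply (E : HilbertBasis ℕ ℂ H) (a : H →L[ℂ] H) :
    shiftCommCLM E a = shiftComm E a := rfl

theorem exists_eq_toeplitz_add_of_hasSum {E : HilbertBasis ℕ ℂ H} {a b : H →L[ℂ] H}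
    (hsa : IsSelfAdjoint a) (ha : ‖a‖ ≤ 1) (hd : IsOffDiagDecaying E a)
    (hs : IsRapidlyDecaying (coeff E (shiftComm E a))) {c : ℤ → ℂ} (hc : IsRapidlyDecayingSeq c)
    (hb : HasSum (fun n ↦ c n • aeval a (Chebyshev.T ℝ n)) b) :
    ∃ (f : C(UnitAddCircle, ℂ)) (c : H →L[ℂ] H), IsSmoothSymbol f ∧ IsSmoothCompact E c ∧
      b = toeplitz E f + c := by
  have habs : ∀ n : ℤ, ((n.natAbs : ℕ) : ℝ) = |(n : ℝ)| := fun n ↦ by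
    rw [Nat.cast_natAbs, Int.cast_abs]
  refine exists_eq_toeplitz_add E (fun m ↦ ?_) fun m ↦ ?_
  · obtain ⟨C, M, h⟩ := exists_coeff_chebyshev_le hsa ha hd m
    obtain ⟨D, hD⟩ := exists_mul_norm_le_of_hasSum hc C M
    refine ⟨D, fun k l ↦ hD (fun n ↦ coeff E (aeval a (Chebyshev.T ℝ n)) k l) _ _ (by positivity)
      ?_ fun n ↦ ?_⟩
    · simpa [coeffCLM_apply] using hb.mapL (coeffCLM E k l)
    · rw [← Chebyshev.T_natAbs, ← habs]
      exact h n.natAbs k l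
  · obtain ⟨C, M, h⟩ := exists_coeff_shiftComm_chebyshev_le hsa ha hd hs m
    obtain ⟨D, hD⟩ := exists_mul_norm_le_of_hasSum hc C M
    refine ⟨D, fun k l ↦ hD (fun n ↦ coeff E (shiftComm E (aeval a (Chebyshev.T ℝ n))) k l) _ _
      (by positivity) ?_ fun n ↦ ?_⟩
    · simpa [coeffCLM_apply, shiftCommCLM_apply] using
        (hb.mapL (shiftCommCLM E)).mapL (coeffCLM E k l)
    · rw [← Chebyshev.T_natAbs, ← habs]
      exact h n.natAbs k l

/-- The Chebyshev expansion of a function gives its continuous functional calculus. -/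
theorem hasSum_cfc_chebyshev {B : Type*} [CStarAlgebra B] {a : B} (hsa : IsSelfAdjoint a)
    (ha : ‖a‖ ≤ 1) {F : ℝ → ℂ} {c : ℤ → ℂ} (hc : Summable fun n ↦ ‖c n‖)
    (h : ∀ x : ℝ, |x| ≤ 1 → HasSum (fun n ↦ c n * (((Chebyshev.T ℝ n).eval x : ℝ) : ℂ)) (F x)) :
    HasSum (fun n ↦ c n • aeval a (Chebyshev.T ℂ n)) (cfc (fun z : ℂ ↦ F z.re) a) := by
  have hn : IsStarNormal a := hsa.isStarNormal
  have hspec : ∀ z ∈ spectrum ℂ a, z = (z.re : ℂ) ∧ |z.re| ≤ 1 := fun z hz ↦ by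
    refine ⟨hsa.mem_spectrum_eq_re hz, (Complex.abs_re_le_norm z).trans ?_⟩
    rcases subsingleton_or_nontrivial B with hB | hB
    · simp [spectrum.of_subsingleton] at hz
    · exact (spectrum.norm_le_norm_of_mem hz).trans ha
  have hT : ∀ n, ∀ z ∈ spectrum ℂ a,
      (Chebyshev.T ℂ n).eval z = (((Chebyshev.T ℝ n).eval z.re : ℝ) : ℂ) := fun n z hz ↦ by
    conv_lhs => rw [(hspec z hz).1]
    rw [Chebyshev.complex_ofReal_eval_T]
  have e : ∀ s : Finset ℤ, ∑ n ∈ s, c n • aeval a (Chebyshev.T ℂ n) =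
      cfc (fun z : ℂ ↦ ∑ n ∈ s, c n * (Chebyshev.T ℂ n).eval z) a := fun s ↦ by
    have h1 : (fun z : ℂ ↦ ∑ n ∈ s, c n * (Chebyshev.T ℂ n).eval z) =
        (∑ n ∈ s, C (c n) * Chebyshev.T ℂ n : ℂ[X]).eval := by
      ext z; simp [eval_finsetSum]
    rw [h1, cfc_polynomial _ a hn, map_sum]
    simp [Algebra.smul_def]
  rw [HasSum]
  simp_rw [e]
  refine tendsto_cfc_fun ?_ (Filter.Eventually.of_forall fun s ↦ by fun_prop)
  -- Weierstrass M-test: |Tₙ| ≤ 1 on the spectrum.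
  refine (tendstoUniformlyOn_tsum (u := fun n ↦ ‖c n‖) hc fun n z hz ↦ ?_).congr_right
    fun z hz ↦ ?_
  · rw [norm_mul, hT n z hz, Complex.norm_real, Real.norm_eq_abs]
    exact mul_le_of_le_one_right (norm_nonneg _)
      (Chebyshev.abs_eval_T_real_le_one n (hspec z hz).2)
  · simp only [hT _ z hz]
    exact (h _ (hspec z hz).2).tsum_eq

/-- A smooth function near a closed set agrees on it with a smooth function on the line. -/
theorem exists_contDiff_eqOn {V K : Set ℝ} (hV : IsOpen V) (hK : IsClosed K) (hKV : K ⊆ V)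
    {f : ℝ → ℂ} (hf : ContDiffOn ℝ ∞ f V) :
    ∃ g : ℝ → ℂ, ContDiff ℝ ∞ g ∧ Set.EqOn g f K := by
  obtain ⟨χ, h0, h1, -⟩ := exists_contMDiffMap_zero_one_nhds_of_isClosed
    (modelWithCornersSelf ℝ ℝ) (n := (⊤ : ℕ∞)) hV.isClosed_compl hK
    (Set.disjoint_left.2 fun x hx hxK ↦ hx (hKV hxK))
  have hχ : ContDiff ℝ ∞ χ := χ.contMDiff.contDiff
  refine ⟨fun x ↦ (χ x : ℂ) * f x, contDiff_iff_contDiffAt.2 fun x ↦ ?_, fun x hx ↦ ?_⟩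
  · by_cases hx : x ∈ V
    · exact (Complex.ofRealCLM.contDiff.comp hχ).contDiffAt.mul
        (hf.contDiffAt (hV.mem_nhds hx))
    -- Outside V nothing is known about f, but the cut-off vanishes near each such point.
    · have h2 : ∀ᶠ y in nhds x, χ y = 0 := Filter.Eventually.filter_mono
        (nhds_le_nhdsSet hx) h0
      refine (contDiffAt_const (c := (0 : ℂ))).congr_of_eventuallyEq ?_
      filter_upwards [h2] with y hy
      simp [hy]
  · have h2 := h1.self_of_nhdsSet x hx
    simp [h2]

/-- The smooth functional calculus of a self-adjoint element as a rapidly converging Chebyshev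
series. -/
theorem exists_hasSum_cfc {B D : Type*} [CStarAlgebra B] [Ring D] [TopologicalSpace D]
    [Algebra ℂ D] (φ : B →ₐ[ℂ] D) (hφ : Continuous φ) {a : B} (hsa : IsSelfAdjoint a)
    {V : Set ℝ} (hV : IsOpen V) (hσ : ∀ x : ℝ, (x : ℂ) ∈ spectrum ℂ a → x ∈ V)
    {f : ℝ → ℂ} (hf : ContDiffOn ℝ ∞ f V) :
    ∃ (r : ℝ) (c : ℤ → ℂ), ‖a‖ ≤ r ∧ 1 ≤ r ∧ IsRapidlyDecayingSeq c ∧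
      HasSum (fun n ↦ c n • aeval (((r⁻¹ : ℝ) : ℂ) • φ a) (Chebyshev.T ℂ n))
        (φ (cfc (fun z : ℂ ↦ f z.re) a)) := by
  obtain ⟨g, hg, hgf⟩ := exists_contDiff_eqOn (K := {x : ℝ | (x : ℂ) ∈ spectrum ℂ a}) hV
    ((spectrum.isClosed a).preimage Complex.continuous_ofReal) hσ hf
  -- The summand 1 ensures r ≥ 1, so scaling by r⁻¹ preserves all decay bounds.
  set r : ℝ := ‖a‖ + 1 with hr
  have hr0 : 0 < r := by positivity
  set s : ℂ := ((r⁻¹ : ℝ) : ℂ) with hs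
  obtain ⟨c, hc, hF⟩ := exists_hasSum_chebyshev (F := fun x ↦ g (r * x))
    (hg.comp (contDiff_const.mul contDiff_id))
  have hsa' : IsSelfAdjoint (s • a) := by
    refine IsSelfAdjoint.smul ?_ hsa
    rw [hs, IsSelfAdjoint, Complex.star_def, Complex.conj_ofReal]
  have hn' : ‖s • a‖ ≤ 1 := by
    rw [norm_smul, hs, Complex.norm_real, Real.norm_of_nonneg (by positivity),
      inv_mul_le_iff₀ hr0]
    linarith
  have hcfc : cfc (fun z : ℂ ↦ f z.re) a = cfc (fun z : ℂ ↦ g (r * z.re)) (s • a) := by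
    have hn : IsStarNormal a := hsa.isStarNormal
    rw [← cfc_comp_smul s (fun z : ℂ ↦ g (r * z.re)) a
      (hg.continuous.comp (continuous_const.mul Complex.continuous_re)).continuousOn hn]
    refine cfc_congr fun z hz ↦ ?_
    have hz' : (z.re : ℂ) ∈ spectrum ℂ a := by rwa [← hsa.mem_spectrum_eq_re hz]
    have : r * (s • z).re = z.re := by
      rw [hs, smul_eq_mul, Complex.re_ofReal_mul, mul_inv_cancel_left₀ hr0.ne']
    simp only [this]
    exact (hgf hz').symm
  -- The calculus is taken in `B`; φ carries the series to `D`, later the operators on H, where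
  -- matrix entries make sense.
  have hsum := (hasSum_cfc_chebyshev hsa' hn' hc.summable_norm hF).map φ hφ
  rw [← hcfc] at hsum
  refine ⟨r, c, by simp [hr], by simp [hr], hc, ?_⟩
  have e : ∀ n, c n • aeval (s • φ a) (Chebyshev.T ℂ n) =
      φ (c n • aeval (s • a) (Chebyshev.T ℂ n)) := fun n ↦ by
    rw [map_smul, ← map_smul φ s a, aeval_algHom_apply]
  rw [_root_.funext e]
  exact hsum

end SmoothToeplitz

end

/-- The value `f(a)` of the continuous functional calculus in the C⋆-algebra `𝒯` is written
`cfc (fun z : ℂ ↦ f z.re) a`: the spectrum of the self-adjoint `a` is real, so that `z.re = z` on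
it, and `f` may be complex-valued. -/
theorem mainTheorem6 {H : Type*} [NormedAddCommGroup H] [InnerProductSpace ℂ H] [CompleteSpace H]
    (E : HilbertBasis ℕ ℂ H)
    (a : SmoothToeplitz.ToeplitzAlgebra E) (ha : a ∈ SmoothToeplitz.smoothToeplitz E)
    (hsa : IsSelfAdjoint a)
    (V : Set ℝ) (hV : IsOpen V) (hσ : ∀ x : ℝ, (x : ℂ) ∈ spectrum ℂ a → x ∈ V)
    (f : ℝ → ℂ) (hf : ContDiffOn ℝ ∞ f V) :
    cfc (fun z : ℂ ↦ f z.re) a ∈ SmoothToeplitz.smoothToeplitz E := by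
  open SmoothToeplitz Polynomial in
  obtain ⟨r, c, hr, hr1, hc, hsum⟩ := exists_hasSum_cfc
    (ToeplitzAlgebra E).subtype.toAlgHom continuous_subtype_val hsa hV hσ hf
  obtain ⟨φ, k, hφ, hk, hak⟩ := ha
  have hd := isOffDiagDecaying_toeplitz_add E hφ hk
  have hsc := isRapidlyDecaying_shiftComm_toeplitz_add E hφ hk
  rw [← hak] at hd hsc
  have hsa' : IsSelfAdjoint (a : H →L[ℂ] H) := congrArg Subtype.val hsa
  have hr' : ‖(a : H →L[ℂ] H)‖ ≤ r := hr
  change HasSum (fun n ↦ c n • aeval (((r⁻¹ : ℝ) : ℂ) • (a : H →L[ℂ] H)) (Chebyshev.T ℂ n))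
    ((cfc (fun z : ℂ ↦ f z.re) a : ToeplitzAlgebra E) : H →L[ℂ] H) at hsum
  change ∃ (f' : C(UnitAddCircle, ℂ)) (c : H →L[ℂ] H), IsSmoothSymbol f' ∧ IsSmoothCompact E c ∧
      ((cfc (fun z : ℂ ↦ f z.re) a : ToeplitzAlgebra E) : H →L[ℂ] H) = toeplitz E f' + c
  generalize (a : H →L[ℂ] H) = A at *
  have hr0 : 0 < r := one_pos.trans_le hr1
  set s : ℂ := ((r⁻¹ : ℝ) : ℂ) with hs
  have hsn : ‖s‖ = r⁻¹ := by rw [hs, Complex.norm_real, Real.norm_of_nonneg (by positivity)]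
  have hs1 : ‖s‖ ≤ 1 := by rw [hsn]; exact inv_le_one_of_one_le₀ hr1
  -- The estimates are stated for real Chebyshev polynomials, the series for complex ones.
  simp_rw [← Chebyshev.map_T (algebraMap ℝ ℂ), aeval_map_algebraMap] at hsum
  refine exists_eq_toeplitz_add_of_hasSum (a := s • A) ?_ ?_ (fun m ↦ ?_) (fun m ↦ ?_) hc hsum
  · refine IsSelfAdjoint.smul ?_ hsa'
    rw [hs, IsSelfAdjoint, Complex.star_def, Complex.conj_ofReal]
  · rwa [norm_smul, hsn, inv_mul_le_iff₀ hr0, mul_one]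
  · obtain ⟨C, hC⟩ := hd m
    refine ⟨C, fun k l ↦ le_trans ?_ (hC k l)⟩
    rw [SmoothToeplitz.coeff_smul, norm_mul]
    gcongr
    exact mul_le_of_le_one_left (norm_nonneg _) hs1
  · obtain ⟨C, hC⟩ := hsc m
    refine ⟨C, fun k l ↦ le_trans ?_ (hC k l)⟩
    rw [← shiftCommCLM_apply, map_smul, shiftCommCLM_apply, SmoothToeplitz.coeff_smul, norm_mul]
    gcongr
    exact mul_le_of_le_one_left (norm_nonneg _) hs1
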